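/- Let $K\ge 1$ and let $\mathcal X_1,\dots,\mathcal X_K$ (non-empty), $\mathcal Y_1,\dots,\mathcal Y_K$ and $\mathcal V$ be measurable spaces (for example finite sets, or Euclidean spaces). Write $X_{\mathcal K_1}=(X_2,\dots,X_K)$. A memoryless many-to-one interference channel is given by transition probabilities $p_{Y_i|X_i}$ for $i=2,\dots,K$ and $p_{V|X_{\mathcal K_1}}$, which are marginals of some joint transition probability of $(V,Y_2,\dots,Y_K)$ given $X_{\mathcal K_1}$, and by a measurable function $f_1$ such that $Y_1=f_1(X_1,V)$ and $V$ is a measurable function of $(Y_1,X_1)$. The channel uses at different times are independent given the inputs. A code of length $T\ge 1$ has, for each user $i$, a finite message set $\mathcal W_i$, an encoder $\phi_i:\mathcal W_i\to\mathcal X_i^T$ and a measurable decoder $\psi_i:\mathcal Y_i^T\to\mathcal W_i$; the messages are independent and uniform, the error probability is $\Pr(\exists i:\psi_i(Y_i^T)\ne W_i)$, and the rates are $R_i=\frac1T\log|\mathcal W_i|$. A rate tuple is achievable if there is a sequence of codes, all of exactly these rates, with error probability tending to $0$; $\mathcal C$ is the closure of the set of achievable rate tuples, and $C_\Sigma=\sup_{R\in\mathcal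 C}\sum_{i=1}^K R_i\in[0,\infty]$. Suppose that $p_{V|X_{\mathcal K_1}}$ is a stochastically degraded version of $\prod_{i=2}^K p_{Y_i|X_i}$, that is, there is a transition probability from $\mathcal Y_2\times\dots\times\mathcal Y_K$ to $\mathcal V$ which, applied to outputs $Y_2,\dots,Y_K$ that are conditionally independent given $X_{\mathcal K_1}$ with laws $p_{Y_i|X_i}$, gives $p_{V|X_{\mathcal K_1}}$. Then $$C_\Sigma=\sup_{p_{X_1},\dots,p_{X_K}}\ \sum_{i=1}^K I(X_i;Y_i),$$ where the supremum is over all product probability distributions $\prod_i p_{X_i}$ of the inputs. Moreover, $C_\Sigma$ is achieved by random coding with interference treated as noise. Given input laws $p_{X_i}$ and rates $R_i\ge0$, let user $i$ have $\lceil e^{TR_i}\rceil$ codewords of length $T$, all symbols of all codewords of all users being independent and those of user $i$ having law $p_{X_i}$; let receiver $i$, using only its own codebook and the single-letter joint law of $(X_i,Y_i)$, choose the unique message whose codeword $x^T$ satisfies $\prod_{\tau=1}^{T}\frac{dP_{X_iY_i}}{d(P_{X_i}\times P_{Y_i})}(x(\tau),y(\tau))>e^{T\gamma_i}$ for a fixed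 threshold $\gamma_i$ (and a fixed message if there is no such unique message). Say that $(R_i)$ is achieved if for some thresholds the error probability averaged over the codebooks tends to $0$ as $T\to\infty$. Then all rates with $R_i=0$ or $0\le R_i<I(X_i;Y_i)$ for each $i$ are achieved, and $C_\Sigma$ is the supremum of $\sum_iR_i$ over all input laws and all rate tuples achieved in this way. If all $\mathcal X_i$ are finite (with all subsets measurable), then the supremum over product input distributions is finite and attained, and it equals $\max_{R\in\mathcal C}\sum_iR_i$. -/

import Mathlib

open MeasureTheory ProbabilityTheory Filter Topology
open scoped ENNReal

noncomputable section

/-! ## Single-letter information quantities -/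

/-- Mutual information (in nats) of the two coordinates of a joint law `P`: the Kullback-Leibler
divergence of `P` from the product of its marginals. -/
def mutualInformation {A B : Type*} [MeasurableSpace A] [MeasurableSpace B]
    (P : Measure (A × B)) : ℝ≥0∞ :=
  InformationTheory.klDiv P (P.fst.prod P.snd)

/-- The likelihood ratio `dP/dQ` of a joint law `P` against the product `Q` of its marginals, with
values in `[0, ∞]`: the quotient of the densities of `P` and `Q` with respect to `P + Q`. It equals
`∞` on the part of `P` that is singular to `Q`. -/
def likelihoodRatio {A B : Type*} [MeasurableSpace A] [MeasurableSpace B]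
    (P : Measure (A × B)) (z : A × B) : ℝ≥0∞ :=
  P.rnDeriv (P + P.fst.prod P.snd) z /
    (P.fst.prod P.snd).rnDeriv (P + P.fst.prod P.snd) z

/-- A codeword `x` and an output block `y` of length `T` are typical for the joint law `P` at
level `γ` if their information density is greater than `T * γ`, that is,
`∏ τ, (dP/dQ)(x τ, y τ) > exp (T * γ)`. -/
def IsTypical {A B : Type*} [MeasurableSpace A] [MeasurableSpace B]
    (P : Measure (A × B)) (γ : ℝ) {T : ℕ} (x : Fin T → A) (y : Fin T → B) : Prop :=
  ENNReal.ofReal (Real.exp (T * γ)) < ∏ τ, likelihoodRatio P (x τ, y τ)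

open Classical in
/-- Typicality decoding with a codebook `cb`: the output is the unique message whose codeword is
typical with the received block, and message `0` if there is no such message or more than one. -/
def typicalityDecoder {A B : Type*} [MeasurableSpace A] [MeasurableSpace B]
    (P : Measure (A × B)) (γ : ℝ) {T M : ℕ} [NeZero M] (cb : Fin M → Fin T → A)
    (y : Fin T → B) : Fin M :=
  if h : ∃! w, IsTypical P γ (cb w) y then h.choose else 0

/-- Number of messages `⌈exp (T * R)⌉` used at rate `R` (in nats) and block length `T`. -/
def messageCount (R : ℝ) (T : ℕ) : ℕ := ⌈Real.exp (T * R)⌉₊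

instance messageCount_neZero (R : ℝ) (T : ℕ) : NeZero (messageCount R T) :=
  ⟨(Nat.ceil_pos.2 (Real.exp_pos _)).ne'⟩

/-! ## The channel -/

/-- A memoryless many-to-one interference channel with `n + 1` users, given by its one-symbol
behaviour. User `0` is the one whose receiver faces interference; the users `i.succ`,
`i : Fin n`, are the others. -/
structure ManyToOneChannel (n : ℕ) (X Y : Fin (n + 1) → Type*) (V : Type*)
    [∀ i, MeasurableSpace (X i)] [∀ i, MeasurableSpace (Y i)] [MeasurableSpace V] where
  /-- The transition law of the direct link of user `i.succ`. -/
  direct : ∀ i : Fin n, Kernel (X i.succ) (Y i.succ)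
  markov_direct : ∀ i, IsMarkovKernel (direct i)
  /-- The joint law of the interference `V` and of the outputs of the users `i.succ`, given the
  inputs of these users. -/
  law : Kernel (∀ i : Fin n, X i.succ) (V × ∀ i : Fin n, Y i.succ)
  markov_law : IsMarkovKernel law
  /-- Given all inputs, the output of user `i.succ` has the law of its direct link. -/
  law_output : ∀ (x : ∀ i : Fin n, X i.succ) (i : Fin n),
    (law x).map (fun q => q.2 i) = direct i (x i)
  /-- The output of user `0` is `f (X₀, V)`. -/
  f : X 0 × V → Y 0
  measurable_f : Measurable f
  /-- The interference is a function of the output and of the input of user `0`. -/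
  invertible : ∃ g : Y 0 × X 0 → V, Measurable g ∧ ∀ x v, g (f (x, v), x) = v

namespace ManyToOneChannel

variable {n : ℕ} {X Y : Fin (n + 1) → Type*} {V : Type*}
  [∀ i, MeasurableSpace (X i)] [∀ i, MeasurableSpace (Y i)] [MeasurableSpace V]

attribute [instance] markov_direct markov_law

/-- The law of the interference `V` given the inputs of the users `i.succ`. -/
def interference (C : ManyToOneChannel n X Y V) : Kernel (∀ i : Fin n, X i.succ) V :=
  C.law.fst

/-- `p(v | x)` is a (stochastically) degraded version of `∏ i, p(y i | x i)`: it is obtained from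
the independent outputs of the direct links by passing them through some channel. -/
def IsDegraded (C : ManyToOneChannel n X Y V) : Prop :=
  ∃ D : Kernel (∀ i : Fin n, Y i.succ) V, IsMarkovKernel D ∧
    ∀ x : ∀ i : Fin n, X i.succ,
      C.interference x = (Measure.pi fun i => C.direct i (x i)).bind D

/-- The tuple of all outputs, as a function of all inputs, the interference and the outputs of the
users `i.succ`. -/
def assemble (C : ManyToOneChannel n X Y V)
    (q : (∀ i, X i) × (V × ∀ i : Fin n, Y i.succ)) : ∀ i, Y i :=
  Fin.cons (C.f (q.1 0, q.2.1)) q.2.2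

lemma measurable_assemble (C : ManyToOneChannel n X Y V) : Measurable C.assemble := by
  refine measurable_pi_lambda _ fun i => ?_
  refine Fin.cases ?_ (fun j => ?_) i
  · exact C.measurable_f.comp
      (((measurable_pi_apply 0).comp measurable_fst).prodMk (measurable_fst.comp measurable_snd))
  · exact (measurable_pi_apply j).comp (measurable_snd.comp measurable_snd)

/-- The one-symbol channel from all inputs to all outputs. -/
def channel (C : ManyToOneChannel n X Y V) : Kernel (∀ i, X i) (∀ i, Y i) :=
  (Kernel.id ×ₖ C.law.comap (fun (x : ∀ i, X i) (i : Fin n) => x i.succ)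
    (measurable_pi_lambda _ fun i => measurable_pi_apply i.succ)).map C.assemble

instance (C : ManyToOneChannel n X Y V) : IsMarkovKernel C.channel :=
  Kernel.IsMarkovKernel.map _ C.measurable_assemble

/-! ## Codes, error probability, capacity -/

/-- Average probability (over independent uniform messages and over `T` memoryless uses of the
channel) that some receiver `i` does not decode the message of user `i`, for the encoders `enc`
and the decoders `dec`. -/
def errorProb (C : ManyToOneChannel n X Y V) {T : ℕ} {M : Fin (n + 1) → ℕ}
    (enc : ∀ i, Fin (M i) → Fin T → X i) (dec : ∀ i, (Fin T → Y i) → Fin (M i)) : ℝ≥0∞ :=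
  (∏ i, (M i : ℝ≥0∞))⁻¹ * ∑ w : ∀ i, Fin (M i),
    (Measure.pi fun τ : Fin T => C.channel fun i => enc i (w i) τ)
      {y | ∃ i, dec i (fun τ => y τ i) ≠ w i}

/-- The rate tuple `R` (in nats per symbol) is achievable: there is a sequence of codes, all of
rate `R`, whose average probability of error vanishes. -/
def Achievable (C : ManyToOneChannel n X Y V) (R : Fin (n + 1) → ℝ) : Prop :=
  ∃ (T : ℕ → ℕ) (M : ℕ → Fin (n + 1) → ℕ)
    (enc : ∀ k i, Fin (M k i) → Fin (T k) → X i)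
    (dec : ∀ k i, (Fin (T k) → Y i) → Fin (M k i)),
    (∀ k, 0 < T k) ∧ (∀ k i, 0 < M k i) ∧ (∀ k i, Measurable (dec k i)) ∧
    (∀ k i, R i = Real.log (M k i) / T k) ∧
    Tendsto (fun k => C.errorProb (enc k) (dec k)) atTop (𝓝 0)

/-- The capacity region: the closure of the set of achievable rate tuples. -/
def capacityRegion (C : ManyToOneChannel n X Y V) : Set (Fin (n + 1) → ℝ) :=
  closure {R | C.Achievable R}

/-- The sum-capacity, in `[0, ∞]`. -/
def sumCapacity (C : ManyToOneChannel n X Y V) : ℝ≥0∞ :=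
  ⨆ R ∈ C.capacityRegion, ENNReal.ofReal (∑ i, R i)

/-! ## Single-letter rates, random coding, interference treated as noise -/

/-- The joint law of the input and the output of user `i` when the inputs of all users are
independent with laws `p`. -/
def userLaw (C : ManyToOneChannel n X Y V) (p : ∀ i, ProbabilityMeasure (X i))
    (i : Fin (n + 1)) : Measure (X i × Y i) :=
  ((Measure.pi fun j => (p j : Measure (X j))) ⊗ₘ C.channel).map fun z => (z.1 i, z.2 i)

/-- `I(X i; Y i)` when the inputs of all users are independent with laws `p`. -/
def userInfo (C : ManyToOneChannel n X Y V) (p : ∀ i, ProbabilityMeasure (X i))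
    (i : Fin (n + 1)) : ℝ≥0∞ :=
  mutualInformation (C.userLaw p i)

/-- The law of the random codebooks: all symbols of all codewords of all users are independent,
those of user `i` having law `p i`. -/
def codebookLaw (p : ∀ i, ProbabilityMeasure (X i)) (T : ℕ) (M : Fin (n + 1) → ℕ) :
    Measure (∀ i, Fin (M i) → Fin T → X i) :=
  Measure.pi fun i => Measure.pi fun _ => Measure.pi fun _ => (p i : Measure (X i))

/-- Random coding with input laws `p` and with interference treated as noise achieves the rate
tuple `R`: the average of the error probability over the random codebooks vanishes as the block
length increases, when each receiver `i` applies typicality decoding with its own codebook only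
and with the single-letter law of `(X i, Y i)`. -/
def RandomCodingAchieves (C : ManyToOneChannel n X Y V) (p : ∀ i, ProbabilityMeasure (X i))
    (R : Fin (n + 1) → ℝ) : Prop :=
  (∀ i, 0 ≤ R i) ∧ ∃ γ : Fin (n + 1) → ℝ,
    Tendsto (fun T : ℕ =>
      ∫⁻ cb, C.errorProb cb (fun i => typicalityDecoder (C.userLaw p i) (γ i) (cb i))
        ∂(codebookLaw p T fun i => messageCount (R i) T)) atTop (𝓝 0)

end ManyToOneChannel

end

noncomputable section

/-! ## Finite products of measures and kernels -/

section Pi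

variable {ι : Type*} [Fintype ι] {A B : ι → Type*} [∀ i, MeasurableSpace (A i)]
  [∀ i, MeasurableSpace (B i)]

/-! Converse. For a block `B` of length `T`, let `D(B)` be the divergence of its law from the
product of its marginals; it measures the dependence over time. Take a code with uniform messages `W
i`. For a user `i ≥ 1` the link is memoryless, and the golden formula with the product of the output
marginals as reference gives `I(W i; Y i^T) + D(Y i^T) ≤ ∑ τ, I(X i τ; Y i τ)`
(`blockSucc_klDiv_le`). For user `0`, given `W 0`, the output block is a coordinatewise image of
`V^T`, so that `I(W 0; Y 0^T) ≤ D(V^T) + ∑ τ, I(X 0 τ; Y 0 τ)` (`blockZero_klDiv_le`): structured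
interference can help user `0`, by at most `D(V^T)`. Degradedness makes the other users pay for it.
In law, `V^T` is the output of a memoryless channel fed with independent blocks `Y i^T`, and the
product of the marginals of `V^T` arises in the same way from the marginals of these blocks; data
processing gives `D(V^T) ≤ ∑ i, D(Y i^T)` (`klDiv_degraded_block_le`). In the sum over all users the
terms `D` cancel, a single-letter bound remains, and `fano` turns it into a bound on rates
(`sum_rate_le`).

Achievability. With i.i.d. codebooks the sent symbols are independent over users and times, so the
interference is memoryless noise. Threshold decoding of the information density fails with
exponentially small probability when the threshold lies between the rate and the mutual information:
Markov's inequality handles wrong codewords and a Chernoff bound the sent one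
(`exists_lintegral_inv_likelihoodRatio_rpow_lt`). No finiteness of the information and no absolute
continuity is needed.

Finite inputs. Output spaces are arbitrary, so continuity of the mutual information in the input law
is obtained from bounded densities with respect to the laws induced by uniform inputs; compactness
of the simplices then gives a maximiser (`continuous_userInfo`). -/

lemma lintegral_pi_prod_eq_prod (μ : ∀ i, Measure (A i)) [∀ i, IsProbabilityMeasure (μ i)]
    {f : ∀ i, A i → ℝ≥0∞} (hf : ∀ i, Measurable (f i)) :
    ∫⁻ x, ∏ i, f i (x i) ∂(Measure.pi μ) = ∏ i, ∫⁻ a, f i a ∂(μ i) := by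
  have h := lintegral_prod_eq_prod_lintegral_of_indepFun Finset.univ
    (fun i (x : ∀ i, A i) => f i (x i)) (iIndepFun_pi (μ := μ) fun i => (hf i).aemeasurable)
    (fun i => (hf i).comp (measurable_pi_apply i))
  rw [h]
  refine Finset.prod_congr rfl fun i _ => ?_
  rw [← (measurePreserving_eval μ i).map_eq, lintegral_map (hf i) (measurable_pi_apply i)]

lemma pi_withDensity (q : ∀ i, Measure (A i)) [∀ i, IsProbabilityMeasure (q i)]
    {r : ∀ i, A i → ℝ≥0∞} (hr : ∀ i, Measurable (r i))
    [∀ i, SigmaFinite ((q i).withDensity (r i))] :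
    Measure.pi (fun i => (q i).withDensity (r i)) =
      (Measure.pi q).withDensity fun x => ∏ i, r i (x i) := by
  refine Measure.pi_eq fun s hs => ?_
  rw [withDensity_apply _ (MeasurableSet.univ_pi hs),
    ← lintegral_indicator (MeasurableSet.univ_pi hs)]
  simp_rw [withDensity_apply _ (hs _), ← lintegral_indicator (hs _)]
  rw [← lintegral_pi_prod_eq_prod q fun i => (hr i).indicator (hs i)]
  refine lintegral_congr fun x => ?_
  by_cases hx : x ∈ Set.univ.pi s
  · rw [Set.indicator_of_mem hx]
    exact Finset.prod_congr rfl fun i _ => (Set.indicator_of_mem (hx i trivial) _).symm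
  · rw [Set.indicator_of_notMem hx]
    simp only [Set.mem_pi, Set.mem_univ, true_implies, not_forall] at hx
    obtain ⟨i, hi⟩ := hx
    exact (Finset.prod_eq_zero (Finset.mem_univ i) (Set.indicator_of_notMem hi _)).symm

/-- The product of finitely many Markov kernels. -/
def piKernel (κ : ∀ i, Kernel (A i) (B i)) [∀ i, IsMarkovKernel (κ i)] :
    Kernel (∀ i, A i) (∀ i, B i) where
  toFun x := Measure.pi fun i => κ i (x i)
  measurable' := by
    refine Measurable.measure_of_isPiSystem_of_isProbabilityMeasure
      generateFrom_pi.symm isPiSystem_pi ?_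
    rintro _ ⟨s, hs, rfl⟩
    simp only [Measure.pi_pi]
    exact Finset.measurable_prod _ fun i _ =>
      ((κ i).measurable_coe (hs i trivial)).comp (measurable_pi_apply i)

lemma piKernel_apply (κ : ∀ i, Kernel (A i) (B i)) [∀ i, IsMarkovKernel (κ i)] (x : ∀ i, A i) :
    piKernel κ x = Measure.pi fun i => κ i (x i) := rfl

instance (κ : ∀ i, Kernel (A i) (B i)) [∀ i, IsMarkovKernel (κ i)] :
    IsMarkovKernel (piKernel κ) :=
  ⟨fun x => by rw [piKernel_apply]; infer_instance⟩

lemma piKernel_comp_pi (κ : ∀ i, Kernel (A i) (B i)) [∀ i, IsMarkovKernel (κ i)]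
    (μ : ∀ i, Measure (A i)) [∀ i, IsProbabilityMeasure (μ i)] :
    (piKernel κ) ∘ₘ (Measure.pi μ) = Measure.pi fun i => κ i ∘ₘ μ i := by
  refine (Measure.pi_eq fun s hs => ?_).symm
  rw [Measure.bind_apply (MeasurableSet.univ_pi hs) (piKernel κ).aemeasurable]
  simp_rw [piKernel_apply, Measure.pi_pi, Measure.bind_apply (hs _) (κ _).aemeasurable]
  exact lintegral_pi_prod_eq_prod μ fun i => (κ i).measurable_coe (hs i)

lemma map_pi_compProd_piKernel (κ : ∀ i, Kernel (A i) (B i)) [∀ i, IsMarkovKernel (κ i)]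
    (μ : ∀ i, Measure (A i)) [∀ i, IsProbabilityMeasure (μ i)] :
    (Measure.pi μ ⊗ₘ piKernel κ).map (fun z i => (z.1 i, z.2 i)) =
      Measure.pi fun i => μ i ⊗ₘ κ i := by
  have hm : Measurable (fun (z : (∀ i, A i) × ∀ i, B i) i => (z.1 i, z.2 i)) := by fun_prop
  refine (Measure.pi_eq fun s hs => ?_).symm
  rw [Measure.map_apply hm (MeasurableSet.univ_pi hs),
    Measure.compProd_apply (hm (MeasurableSet.univ_pi hs))]
  simp_rw [Measure.compProd_apply (hs _)]
  rw [← lintegral_pi_prod_eq_prod μ fun i => Kernel.measurable_kernel_prodMk_left (hs i)]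
  refine lintegral_congr fun x => ?_
  rw [piKernel_apply, ← Measure.pi_pi]
  congr 1

/-- Codebooks and outputs of single users are products over users of blocks in time, while the
channel acts as a product over time; this passes between the two orders. It suffices to compare
boxes in both indices. -/
lemma map_pi_pi_swap {κ : Type*} [Fintype κ] (μ : ∀ i, κ → Measure (A i))
    [∀ i t, IsProbabilityMeasure (μ i t)] :
    (Measure.pi fun i => Measure.pi fun t => μ i t).map (fun x t i => x i t) =
      Measure.pi fun t => Measure.pi fun i => μ i t := by
  have hm : Measurable (fun (x : ∀ i, κ → A i) t i => x i t) := by fun_prop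
  symm
  refine Measure.pi_eq_generateFrom (C := fun _ => Set.pi Set.univ ''
    Set.pi Set.univ fun i => {s : Set (A i) | MeasurableSet s})
    (fun _ => generateFrom_pi) (fun _ => isPiSystem_pi)
    (fun t => ⟨fun _ => Set.univ, fun _ => ⟨fun _ => Set.univ, by simp, by simp⟩,
      fun _ => measure_lt_top _ _, Set.iUnion_const _⟩) fun s hs => ?_
  choose r hr hrs using hs
  obtain rfl : (fun t => Set.univ.pi (r t)) = s := funext hrs
  rw [Measure.map_apply hm (MeasurableSet.univ_pi fun t => MeasurableSet.univ_pi
    fun i => hr t i trivial)]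
  have : (fun (x : ∀ i, κ → A i) t i => x i t) ⁻¹' (Set.univ.pi fun t => Set.univ.pi (r t)) =
      Set.univ.pi fun i => Set.univ.pi fun t => r t i := by
    ext x; simp only [Set.mem_preimage, Set.mem_pi, Set.mem_univ, true_implies]
    exact forall_comm
  rw [this]
  simp_rw [Measure.pi_pi]
  exact Finset.prod_comm

end Pi

/-! ## Kullback-Leibler divergence -/

section KL

open InformationTheory Real

variable {A B : Type*} [MeasurableSpace A] [MeasurableSpace B]

lemma llr_ae_eq_add {μ ν ρ : Measure A} [IsProbabilityMeasure μ] [IsProbabilityMeasure ν]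
    [IsProbabilityMeasure ρ] (hμν : μ ≪ ν) (hνρ : ν ≪ ρ) :
    llr μ ρ =ᵐ[μ] fun x => llr μ ν x + llr ν ρ x := by
  have hμρ := hμν.trans hνρ
  filter_upwards [hμρ (Measure.rnDeriv_mul_rnDeriv (κ := ρ) hμν), Measure.rnDeriv_pos hμν,
    hμν (Measure.rnDeriv_pos hνρ), hμν (Measure.rnDeriv_lt_top μ ν),
    hμρ (Measure.rnDeriv_lt_top ν ρ)] with x hx h1 h2 h3 h4
  simp only [llr, ← hx, Pi.mul_apply, ENNReal.toReal_mul]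
  exact Real.log_mul (ENNReal.toReal_pos h1.ne' h3.ne).ne' (ENNReal.toReal_pos h2.ne' h4.ne).ne'

/-- Log-likelihood ratios add along `μ ≪ ν ≪ ρ`. Only an inequality is kept, because
`ENNReal.ofReal` truncates an integral that may be negative. -/
lemma klDiv_le_add_integral_llr {μ ν ρ : Measure A} [IsProbabilityMeasure μ]
    [IsProbabilityMeasure ν] [IsProbabilityMeasure ρ] (h : klDiv μ ν ≠ ∞) (hνρ : ν ≪ ρ)
    (hint : Integrable (llr ν ρ) μ) :
    klDiv μ ρ ≤ klDiv μ ν + ENNReal.ofReal (∫ x, llr ν ρ x ∂μ) := by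
  obtain ⟨hμν, hi⟩ := klDiv_ne_top_iff.1 h
  have hae := llr_ae_eq_add hμν hνρ
  rw [klDiv_of_ac_of_integrable (hμν.trans hνρ) ((hi.add hint).congr hae.symm),
    klDiv_of_ac_of_integrable hμν hi, integral_congr_ae hae, integral_add hi hint]
  simp only [probReal_univ, add_sub_cancel_right]
  exact ENNReal.ofReal_add_le

lemma klDiv_map_measurableEquiv (μ ν : Measure A) [IsFiniteMeasure μ] [IsFiniteMeasure ν]
    (e : A ≃ᵐ B) : klDiv (μ.map e) (ν.map e) = klDiv μ ν := by
  refine le_antisymm (klDiv_map_le μ ν e.measurable) ?_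
  have := klDiv_map_le (μ.map e) (ν.map e) e.symm.measurable
  simpa [Measure.map_map e.symm.measurable e.measurable] using this

/-- The divergence of a law on a finite product from a product law is at most its divergence from
the product of its marginals plus the divergences of the marginals. -/
lemma klDiv_pi_le {ι : Type*} [Fintype ι] {B : ι → Type*} [∀ i, MeasurableSpace (B i)]
    (μ : Measure (∀ i, B i)) [IsProbabilityMeasure μ]
    (q : ∀ i, Measure (B i)) [∀ i, IsProbabilityMeasure (q i)] :
    klDiv μ (Measure.pi q) ≤ klDiv μ (Measure.pi fun i => μ.map (Function.eval i)) +
      ∑ i, klDiv (μ.map (Function.eval i)) (q i) := by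
  have hm (i) : IsProbabilityMeasure (μ.map (Function.eval i)) :=
    Measure.isProbabilityMeasure_map (measurable_pi_apply i).aemeasurable
  set m : ∀ i, Measure (B i) := fun i => μ.map (Function.eval i) with hm_def
  change ∀ i, IsProbabilityMeasure (m i) at hm
  by_cases h1 : klDiv μ (Measure.pi m) = ∞
  · simp [h1]
  by_cases h2 : ∑ i, klDiv (m i) (q i) = ∞
  · change _ ≤ _ + ∑ i, klDiv (m i) (q i)
    simp [h2]
  have h3 (i) : klDiv (m i) (q i) ≠ ∞ := fun h =>
    h2 (ENNReal.sum_eq_top.2 ⟨i, Finset.mem_univ i, h⟩)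
  have hac (i) := (klDiv_ne_top_iff.1 (h3 i)).1
  have hi (i) := (klDiv_ne_top_iff.1 (h3 i)).2
  have hwd (i) : (q i).withDensity ((m i).rnDeriv (q i)) = m i :=
    Measure.withDensity_rnDeriv_eq _ _ (hac i)
  have hsf (i) : SigmaFinite ((q i).withDensity ((m i).rnDeriv (q i))) := by
    rw [hwd i]; infer_instance
  have hpi : Measure.pi m = (Measure.pi q).withDensity fun x => ∏ i, (m i).rnDeriv (q i) (x i) := by
    rw [← pi_withDensity q fun i => Measure.measurable_rnDeriv (m i) (q i)]
    simp_rw [hwd]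
  have hpac : Measure.pi m ≪ Measure.pi q := by
    rw [hpi]; exact withDensity_absolutelyContinuous _ _
  have hrn : (Measure.pi m).rnDeriv (Measure.pi q) =ᵐ[Measure.pi q]
      fun x => ∏ i, (m i).rnDeriv (q i) (x i) := by
    conv_lhs => rw [hpi]
    exact Measure.rnDeriv_withDensity _ (Finset.measurable_prod _ fun i _ =>
      (Measure.measurable_rnDeriv _ _).comp (measurable_pi_apply i))
  -- The log-likelihood ratio of two product laws is a sum of functions of one coordinate, so its
  -- integral against `μ` sees only the marginals of `μ`.
  have hllr : llr (Measure.pi m) (Measure.pi q) =ᵐ[Measure.pi m]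
      fun x => ∑ i, llr (m i) (q i) (x i) := by
    have hpos : ∀ᵐ x ∂(Measure.pi m), ∀ i, 0 < ((m i).rnDeriv (q i) (x i)).toReal := by
      refine eventually_all.2 fun i => Measure.tendsto_eval_ae_ae.eventually
        (p := fun a => 0 < ((m i).rnDeriv (q i) a).toReal) ?_
      filter_upwards [Measure.rnDeriv_pos (hac i), hac i (Measure.rnDeriv_lt_top (m i) (q i))]
        with a h h' using ENNReal.toReal_pos h.ne' h'.ne
    filter_upwards [hpac hrn, hpos] with x hx hx'
    simp only [llr, hx, ENNReal.toReal_prod]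
    exact Real.log_prod fun i _ => (hx' i).ne'
  have hμac := (klDiv_ne_top_iff.1 h1).1
  have hint (i) : Integrable (fun x : ∀ i, B i => llr (m i) (q i) (x i)) μ :=
    (integrable_map_measure (hi i).aestronglyMeasurable
      (measurable_pi_apply i).aemeasurable).1 (hi i)
  have hsum := integrable_finsetSum Finset.univ fun i _ => hint i
  refine (klDiv_le_add_integral_llr h1 hpac (hsum.congr (hμac.ae_eq hllr).symm)).trans ?_
  gcongr
  rw [integral_congr_ae (hμac.ae_eq hllr), integral_finsetSum _ fun i _ => hint i]
  refine (Finset.le_sum_of_subadditive ENNReal.ofReal ENNReal.ofReal_zero.le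
    (fun _ _ => ENNReal.ofReal_add_le) _ _).trans (Finset.sum_le_sum fun i _ => ?_)
  rw [klDiv_of_ac_of_integrable (hac i) (hi i)]
  simp only [probReal_univ, add_sub_cancel_right]
  rw [← integral_map (φ := Function.eval i) (measurable_pi_apply i).aemeasurable
    (hi i).aestronglyMeasurable]

lemma klDiv_pi_pi_le {ι : Type*} [Fintype ι] {B : ι → Type*} [∀ i, MeasurableSpace (B i)]
    (m q : ∀ i, Measure (B i)) [∀ i, IsProbabilityMeasure (m i)]
    [∀ i, IsProbabilityMeasure (q i)] :
    klDiv (Measure.pi m) (Measure.pi q) ≤ ∑ i, klDiv (m i) (q i) := by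
  refine (klDiv_pi_le (Measure.pi m) q).trans ?_
  simp_rw [(measurePreserving_eval m _).map_eq]
  simp

/-- The density of the joint laws is the density of the kernels on each fibre. If absolute
continuity fails, it fails at an atom of positive mass, and both sides are infinite. -/
lemma klDiv_compProd_eq_sum [Fintype A] [MeasurableSingletonClass A] (u : Measure A)
    [IsProbabilityMeasure u] (κ η : Kernel A B) [IsMarkovKernel κ] [IsMarkovKernel η] :
    klDiv (u ⊗ₘ κ) (u ⊗ₘ η) = ∑ x, u {x} * klDiv (κ x) (η x) := by
  by_cases hac : ∀ᵐ x ∂u, κ x ≪ η x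
  · have hac' := Measure.absolutelyContinuous_compProd_right_iff.2 hac
    have hr : (u ⊗ₘ κ).rnDeriv (u ⊗ₘ η) =ᵐ[u ⊗ₘ η] fun z => κ.rnDeriv η z.1 z.2 := by
      have h1 : u ⊗ₘ κ = (u ⊗ₘ η).withDensity fun z => κ.rnDeriv η z.1 z.2 := by
        have : IsFiniteKernel (η.withDensity (κ.rnDeriv η)) := inferInstance
        rw [← Measure.compProd_withDensity (Kernel.measurable_rnDeriv κ η)]
        refine Measure.compProd_congr ?_
        filter_upwards [hac] with x hx
        exact (Kernel.withDensity_rnDeriv_eq hx).symm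
      conv_lhs => rw [h1]
      exact Measure.rnDeriv_withDensity _ (Kernel.measurable_rnDeriv κ η)
    rw [klDiv_eq_lintegral_klFun_of_ac hac']
    have hr' : (fun z => ENNReal.ofReal (klFun ((u ⊗ₘ κ).rnDeriv (u ⊗ₘ η) z).toReal))
        =ᵐ[u ⊗ₘ η] fun z => ENNReal.ofReal (klFun (κ.rnDeriv η z.1 z.2).toReal) := by
      filter_upwards [hr] with z hz
      rw [hz]
    rw [lintegral_congr_ae hr', Measure.lintegral_compProd, lintegral_fintype]
    · refine Finset.sum_congr rfl fun x _ => ?_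
      rw [mul_comm]
      by_cases hx : u {x} = 0
      · simp [hx]
      congr 1
      have hx' : κ x ≪ η x := by
        by_contra hcon
        exact hx (measure_mono_null (by simpa using hcon) hac)
      rw [klDiv_eq_lintegral_klFun_of_ac hx']
      refine lintegral_congr_ae ?_
      filter_upwards [Kernel.rnDeriv_eq_rnDeriv_measure (κ := κ) (η := η) (a := x)] with y hy
      rw [hy]
    · exact ((measurable_klFun.comp
        (Kernel.measurable_rnDeriv κ η).ennreal_toReal)).ennreal_ofReal
  · rw [klDiv_of_not_ac fun h => hac (Measure.absolutelyContinuous_compProd_right_iff.1 h)]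
    symm
    rw [ENNReal.sum_eq_top]
    by_contra! hcon
    refine hac ?_
    rw [ae_iff_of_countable]
    intro x hx
    by_contra hnac
    exact hcon x (Finset.mem_univ x) (by rw [klDiv_of_not_ac hnac, ENNReal.mul_top hx])

/-- This is `klDiv_pi_le` averaged over the input. The constant `c` bounds the dependence left among
the coordinates once the input is known: `0` for a memoryless link, the dependence over time of the
interference for user `0`. -/
lemma klDiv_compProd_pi_le [Fintype A] [MeasurableSingletonClass A] (u : Measure A)
    [IsProbabilityMeasure u] {ι : Type*} [Fintype ι] {B : ι → Type*}
    [∀ i, MeasurableSpace (B i)] (K : Kernel A (∀ i, B i)) [IsMarkovKernel K]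
    (q : ∀ i, Measure (B i)) [∀ i, IsProbabilityMeasure (q i)] (c : ℝ≥0∞)
    (hc : ∀ a, klDiv (K a) (Measure.pi fun i => (K a).map (Function.eval i)) ≤ c) :
    klDiv (u ⊗ₘ K) (u.prod (Measure.pi q)) ≤
      c + ∑ i, klDiv (u ⊗ₘ K.map (Function.eval i)) (u.prod (q i)) := by
  have (i : ι) : IsMarkovKernel (K.map (Function.eval i)) :=
    Kernel.IsMarkovKernel.map _ (measurable_pi_apply i)
  simp_rw [← Measure.compProd_const, klDiv_compProd_eq_sum, Kernel.const_apply,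
    Kernel.map_apply _ (measurable_pi_apply _)]
  calc ∑ a, u {a} * klDiv (K a) (Measure.pi q)
      ≤ ∑ a, (u {a} * c + ∑ i, u {a} * klDiv ((K a).map (Function.eval i)) (q i)) := by
        refine Finset.sum_le_sum fun a _ => ?_
        rw [← Finset.mul_sum, ← mul_add]
        gcongr
        exact (klDiv_pi_le (K a) q).trans (by gcongr; exact hc a)
    _ = c + ∑ i, ∑ a, u {a} * klDiv ((K a).map (Function.eval i)) (q i) := by
        rw [Finset.sum_add_distrib, Finset.sum_comm, ← Finset.sum_mul]
        simp

/-- Golden formula, as an inequality. -/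
lemma klDiv_compProd_add_klDiv_le [StandardBorelSpace A] [Nonempty A] (u : Measure A)
    [IsProbabilityMeasure u] (κ : Kernel A B) [IsMarkovKernel κ] (q : Measure B)
    [IsProbabilityMeasure q] :
    klDiv (u ⊗ₘ κ) (u.prod (κ ∘ₘ u)) + klDiv (κ ∘ₘ u) q ≤ klDiv (u ⊗ₘ κ) (u.prod q) := by
  -- The chain rule is applied with the output as first coordinate. The disintegration along the
  -- output requires regularity of the input space only, which here is a finite message set; the
  -- output space stays arbitrary.
  set P := (u ⊗ₘ κ).map Prod.swap with hP
  have hPp : IsProbabilityMeasure P :=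
    Measure.isProbabilityMeasure_map measurable_swap.aemeasurable
  have hb : P.fst = κ ∘ₘ u := by
    rw [hP, Measure.fst_map_swap, Measure.snd_compProd]
  have hdis : (κ ∘ₘ u) ⊗ₘ P.condKernel = P := by rw [← hb]; exact P.disintegrate _
  have hsw (ν : Measure B) [IsProbabilityMeasure ν] :
      klDiv (u ⊗ₘ κ) (u.prod ν) = klDiv ((κ ∘ₘ u) ⊗ₘ P.condKernel) (ν ⊗ₘ Kernel.const B u) := by
    have h : ν.prod u = (u.prod ν).map Prod.swap := Measure.prod_swap.symm
    rw [hdis, Measure.compProd_const, h, hP]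
    exact (klDiv_map_measurableEquiv (u ⊗ₘ κ) (u.prod ν) MeasurableEquiv.prodComm).symm
  rw [hsw, hsw q, klDiv_compProd_eq_add (κ ∘ₘ u) q, add_comm]

/-- Passing from a channel input to a finite random variable of which it is a function does not
increase the divergence. -/
lemma klDiv_compProd_comap_le [StandardBorelSpace A] [Nonempty A] {X : Type*} [MeasurableSpace X]
    (u : Measure A) [IsProbabilityMeasure u] {φ : A → X} (hφ : Measurable φ)
    (κ η : Kernel X B) [IsMarkovKernel κ] [IsMarkovKernel η] :
    klDiv (u ⊗ₘ κ.comap φ hφ) (u ⊗ₘ η.comap φ hφ) ≤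
      klDiv (u.map φ ⊗ₘ κ) (u.map φ ⊗ₘ η) := by
  have hp : IsProbabilityMeasure (u.map φ) := Measure.isProbabilityMeasure_map hφ.aemeasurable
  -- Given the symbol, the output does not depend on the message. Hence the message can be resampled
  -- from its conditional law `β` given the symbol, and the kernel `Γ`, which does this and keeps
  -- the output, maps one pair of laws to the other; data processing applies.
  set β : Kernel X A := condDistrib id φ u with hβ
  have hβu : u.map φ ⊗ₘ β = u.map fun a => (φ a, a) :=
    compProd_map_condDistrib (X := φ) aemeasurable_id
  set Γ : Kernel (X × B) (A × B) := (β.comap Prod.fst measurable_fst) ×ₖ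
    (Kernel.deterministic Prod.snd measurable_snd) with hΓ
  have key (θ : Kernel X B) [IsMarkovKernel θ] :
      Γ ∘ₘ (u.map φ ⊗ₘ θ) = u ⊗ₘ θ.comap φ hφ := by
    refine Measure.ext_prod fun {s t} hs ht => ?_
    have hθt := θ.measurable_coe ht
    have hβs := β.measurable_coe hs
    rw [Measure.bind_apply (hs.prod ht) Γ.aemeasurable, Measure.compProd_apply_prod hs ht,
      Measure.lintegral_compProd (Γ.measurable_coe (hs.prod ht))]
    have h1 (x : X) : ∫⁻ y, Γ (x, y) (s ×ˢ t) ∂(θ x) = ∫⁻ a, s.indicator 1 a * θ x t ∂(β x) := by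
      simp only [hΓ, Kernel.prod_apply, Measure.prod_prod, Kernel.comap_apply,
        Kernel.deterministic_apply, Measure.dirac_apply' _ ht]
      rw [lintegral_const_mul _ (measurable_one.indicator ht), lintegral_indicator_one ht,
        lintegral_mul_const _ (measurable_one.indicator hs), lintegral_indicator_one hs]
    simp_rw [h1]
    have hm : Measurable fun z : X × A => s.indicator (1 : A → ℝ≥0∞) z.2 * θ z.1 t :=
      ((measurable_one.indicator hs).comp measurable_snd).mul (hθt.comp measurable_fst)
    rw [← Measure.lintegral_compProd hm, hβu, lintegral_map hm (by fun_prop),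
      ← lintegral_indicator hs]
    refine lintegral_congr fun a => ?_
    by_cases ha : a ∈ s <;> simp [ha, Kernel.comap_apply]
  rw [← key κ, ← key η]
  exact klDiv_comp_right_le _ _ Γ

/-- The left side is the tangent line at `c` of the convex function `klFun`. -/
lemma mul_log_add_le_klFun {r c : ℝ} (hr : 0 ≤ r) (hc : 0 < c) :
    r * log c + (1 - c) ≤ klFun r := by
  rcases hr.eq_or_lt with rfl | hr
  · simp [klFun_zero, hc.le]
  · have := Real.log_le_sub_one_of_pos (div_pos hc hr)
    rw [Real.log_div hc.ne' hr.ne'] at this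
    have h2 := mul_le_mul_of_nonneg_left this hr.le
    rw [klFun_apply]
    have h3 : r * (c / r - 1) = c - r := by field_simp
    rw [h3] at h2
    linarith

/-- Integrate the tangent line at `a` over `E` and the one at `b` over its complement. The best
choice, the ratio of the two probabilities on each piece, would give the binary divergence; free
parameters avoid degenerate cases. -/
lemma le_toReal_klDiv_of_event (P Q : Measure A) [IsProbabilityMeasure P] [IsProbabilityMeasure Q]
    (h : klDiv P Q ≠ ∞) {E : Set A} (hE : MeasurableSet E) {a b : ℝ} (ha : 0 < a) (hb : 0 < b) :
    P.real E * log a + Q.real E * (1 - a) + (P.real Eᶜ * log b + Q.real Eᶜ * (1 - b)) ≤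
      (klDiv P Q).toReal := by
  classical
  obtain ⟨hac, hi⟩ := klDiv_ne_top_iff.1 h
  rw [toReal_klDiv_eq_integral_klFun hac]
  have hint : Integrable (fun x => klFun (P.rnDeriv Q x).toReal) Q :=
    (integrable_klFun_rnDeriv_iff hac).2 hi
  have hr : Integrable (fun x => (P.rnDeriv Q x).toReal) Q := Measure.integrable_toReal_rnDeriv
  have hset {F : Set A} (hF : MeasurableSet F) {c : ℝ} (hc : 0 < c) :
      P.real F * log c + Q.real F * (1 - c) ≤ ∫ x in F, klFun (P.rnDeriv Q x).toReal ∂Q := by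
    calc P.real F * log c + Q.real F * (1 - c)
        = ∫ x in F, ((P.rnDeriv Q x).toReal * log c + (1 - c)) ∂Q := by
          rw [integral_add (hr.integrableOn.mul_const _) (integrable_const _),
            integral_mul_const, Measure.setIntegral_toReal_rnDeriv hac]
          simp
      _ ≤ _ := integral_mono ((hr.integrableOn.mul_const _).add (integrable_const _))
          hint.integrableOn fun x => mul_log_add_le_klFun ENNReal.toReal_nonneg hc
  rw [← integral_add_compl hE hint]
  exact add_le_add (hset hE ha) (hset hE.compl hb)

/-- The uniform distribution on `Fin M`. -/
def uniformFin (M : ℕ) : Measure (Fin M) := (M : ℝ≥0∞)⁻¹ • Measure.count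

instance (M : ℕ) [NeZero M] : IsProbabilityMeasure (uniformFin M) := by
  constructor
  simp only [uniformFin, Measure.smul_apply, smul_eq_mul, Measure.count_univ,
    ENat.card_eq_coe_fintype_card, Fintype.card_fin, ENat.toENNReal_coe]
  exact ENNReal.inv_mul_cancel (by simp [NeZero.ne]) (by simp)

lemma lintegral_uniformFin (M : ℕ) (f : Fin M → ℝ≥0∞) :
    ∫⁻ w, f w ∂(uniformFin M) = (M : ℝ≥0∞)⁻¹ * ∑ w, f w := by
  rw [uniformFin, lintegral_smul_measure, lintegral_count, tsum_fintype, smul_eq_mul]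

/-- Fano's inequality, with a free parameter `s` in place of the optimal one. -/
lemma fano {M : ℕ} [NeZero M] (K : Kernel (Fin M) B) [IsMarkovKernel K] (q : Measure B)
    [IsProbabilityMeasure q] {dec : B → Fin M} (hdec : Measurable dec) {s ε : ℝ} (hs : 0 < s)
    (hs' : s ≤ 1 / 2) (hε : 0 ≤ ε)
    (hK : (uniformFin M ⊗ₘ K) {z | dec z.2 ≠ z.1} ≤ ENNReal.ofReal ε)
    (hfin : klDiv (uniformFin M ⊗ₘ K) ((uniformFin M).prod q) ≠ ∞) :
    (1 - ε) * (log M + log (1 - s)) + ε * log s ≤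
      (klDiv (uniformFin M ⊗ₘ K) ((uniformFin M).prod q)).toReal := by
  have hM : (1 : ℝ) ≤ M := by exact_mod_cast NeZero.one_le
  have hM0 : (0 : ℝ) < M := by linarith
  have hEc : MeasurableSet {z : Fin M × B | dec z.2 ≠ z.1} :=
    (measurableSet_eq_fun (hdec.comp measurable_snd) measurable_fst).compl
  have hE := hEc.compl
  -- Under the product law correct decoding has probability `1 / M`. With these slopes the terms
  -- that do not involve logarithms add up to `s / M ≥ 0` and can be dropped.
  have key := le_toReal_klDiv_of_event _ _ hfin hE (a := M * (1 - s)) (b := s)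
    (mul_pos hM0 (by linarith)) hs
  rw [compl_compl] at key
  have hQ : ((uniformFin M).prod q).real {z : Fin M × B | dec z.2 ≠ z.1}ᶜ = (M : ℝ)⁻¹ := by
    rw [measureReal_def, Measure.prod_apply hE, lintegral_uniformFin]
    have : ∑ w, q (Prod.mk w ⁻¹' {z : Fin M × B | dec z.2 ≠ z.1}ᶜ) = 1 := by
      have h1 : ∀ w, Prod.mk w ⁻¹' {z : Fin M × B | dec z.2 ≠ z.1}ᶜ = dec ⁻¹' {w} := by
        intro w; ext y; simp
      simp_rw [h1]
      rw [← measure_biUnion_finset]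
      · convert measure_univ (μ := q)
        ext y; simp
      · intro w _ w' _ hww'
        exact Disjoint.preimage _ (by simpa using hww')
      · exact fun w _ => hdec (measurableSet_singleton w)
    rw [this]; simp
  have hQc : ((uniformFin M).prod q).real {z : Fin M × B | dec z.2 ≠ z.1} = 1 - (M : ℝ)⁻¹ := by
    have := probReal_add_probReal_compl (μ := (uniformFin M).prod q) hEc
    linarith
  set p := (uniformFin M ⊗ₘ K).real {z : Fin M × B | dec z.2 ≠ z.1} with hp
  have hPE : (uniformFin M ⊗ₘ K).real {z : Fin M × B | dec z.2 ≠ z.1}ᶜ = 1 - p := by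
    have := probReal_add_probReal_compl (μ := uniformFin M ⊗ₘ K) hEc
    linarith
  have hpε : p ≤ ε := ENNReal.toReal_le_of_le_ofReal hε hK
  rw [hQ, hQc, hPE, Real.log_mul hM0.ne' (by linarith)] at key
  have h1 : log s ≤ log (1 - s) := Real.log_le_log hs (by linarith)
  have h2 : 0 ≤ log M := Real.log_nonneg hM
  have h3 : (M : ℝ)⁻¹ * (1 - M * (1 - s)) + (1 - (M : ℝ)⁻¹) * (1 - s) = (M : ℝ)⁻¹ * s := by
    field_simp; ring
  have h4 : 0 ≤ (M : ℝ)⁻¹ * s := by positivity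
  -- The bound decreases in the error probability, since `log s ≤ log M + log (1 - s)`; so `p` may
  -- be replaced by the larger `ε`.
  nlinarith [mul_nonneg (sub_nonneg.2 hpε) (by linarith : 0 ≤ log M + log (1 - s) - log s)]

end KL

/-! ## Marginals of the channel -/

lemma map_piKernel_comp_eval {ι : Type*} [Fintype ι] {A B : ι → Type*}
    [∀ i, MeasurableSpace (A i)] [∀ i, MeasurableSpace (B i)]
    (κ : ∀ i, Kernel (A i) (B i)) [∀ i, IsMarkovKernel (κ i)] (μ : Measure (∀ i, A i)) (i : ι) :
    (piKernel κ ∘ₘ μ).map (Function.eval i) = κ i ∘ₘ (μ.map (Function.eval i)) := by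
  have he : Measurable (Function.eval i : (∀ i, A i) → A i) := measurable_pi_apply i
  have he' : Measurable (Function.eval i : (∀ i, B i) → B i) := measurable_pi_apply i
  ext s hs
  rw [Measure.map_apply he' hs, Measure.bind_apply (he' hs) (piKernel κ).aemeasurable,
    Measure.bind_apply hs (κ i).aemeasurable, lintegral_map ((κ i).measurable_coe hs) he]
  refine lintegral_congr fun x => ?_
  rw [piKernel_apply, ← Measure.map_apply he' hs, (measurePreserving_eval _ i).map_eq]

lemma mutualInformation_compProd {A B : Type*} [MeasurableSpace A] [MeasurableSpace B]
    (p : Measure A) [IsProbabilityMeasure p] (κ : Kernel A B) [IsMarkovKernel κ] :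
    mutualInformation (p ⊗ₘ κ) = InformationTheory.klDiv (p ⊗ₘ κ) (p.prod (κ ∘ₘ p)) := by
  rw [mutualInformation, Measure.fst_compProd, Measure.snd_compProd]

lemma lintegral_pi_uniformFin {ι : Type*} [Fintype ι] [DecidableEq ι] (M : ι → ℕ)
    [∀ i, NeZero (M i)]
    (f : (∀ i, Fin (M i)) → ℝ≥0∞) :
    ∫⁻ w, f w ∂(Measure.pi fun i => uniformFin (M i)) = (∏ i, (M i : ℝ≥0∞))⁻¹ * ∑ w, f w := by
  rw [lintegral_fintype, Finset.mul_sum]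
  refine Finset.sum_congr rfl fun w _ => ?_
  rw [mul_comm, Measure.pi_singleton]
  congr 1
  rw [ENNReal.prod_inv_distrib]
  · refine Finset.prod_congr rfl fun i _ => ?_
    simp [uniformFin]
  · intro i _ j _ _
    simp [NeZero.ne]

lemma map_pi_succ {n : ℕ} {A : Fin (n + 1) → Type*} [∀ i, MeasurableSpace (A i)]
    (μ : ∀ i, Measure (A i)) [∀ i, IsProbabilityMeasure (μ i)] :
    (Measure.pi μ).map (fun x => (x 0, fun j : Fin n => x j.succ)) =
      (μ 0).prod (Measure.pi fun j : Fin n => μ j.succ) := by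
  have hc : Measurable fun z : A 0 × (∀ j : Fin n, A j.succ) => (Fin.cons z.1 z.2 : ∀ i, A i) := by
    refine measurable_pi_lambda _ fun i => Fin.cases ?_ (fun j => ?_) i
    · exact measurable_fst
    · exact (measurable_pi_apply j).comp measurable_snd
  have h : Measure.pi μ = ((μ 0).prod (Measure.pi fun j : Fin n => μ j.succ)).map
      fun z => (Fin.cons z.1 z.2 : ∀ i, A i) := by
    refine Measure.pi_eq fun s hs => ?_
    rw [Measure.map_apply hc (MeasurableSet.univ_pi hs), Fin.prod_univ_succ, ← Measure.pi_pi,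
      ← Measure.prod_prod]
    congr 1
    ext z
    simp [Fin.forall_fin_succ]
  rw [h, Measure.map_map (by fun_prop) hc]
  exact Measure.map_id

namespace ManyToOneChannel

variable {n : ℕ} {X Y : Fin (n + 1) → Type*} {V : Type*}
  [∀ i, MeasurableSpace (X i)] [∀ i, MeasurableSpace (Y i)] [MeasurableSpace V]
  (C : ManyToOneChannel n X Y V)

instance : IsMarkovKernel C.interference := by unfold interference; infer_instance

lemma measurable_f_right (x : X 0) : Measurable fun v => C.f (x, v) :=
  C.measurable_f.comp measurable_prodMk_left

lemma measurable_assemble_right (x : ∀ i, X i) : Measurable fun q => C.assemble (x, q) :=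
  C.measurable_assemble.comp measurable_prodMk_left

lemma channel_apply (x : ∀ i, X i) :
    C.channel x = (C.law fun i => x i.succ).map fun q => C.assemble (x, q) := by
  rw [channel, Kernel.map_apply _ C.measurable_assemble, Kernel.prod_apply, Kernel.id_apply,
    Measure.dirac_prod, Measure.map_map C.measurable_assemble measurable_prodMk_left,
    Kernel.comap_apply]
  rfl

lemma channel_map_succ (x : ∀ i, X i) (i : Fin n) :
    (C.channel x).map (Function.eval i.succ) = C.direct i (x i.succ) := by
  rw [channel_apply, Measure.map_map (g := Function.eval _) (measurable_pi_apply _)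
    (C.measurable_assemble_right x), ← C.law_output (fun i => x i.succ) i]
  rfl

lemma channel_map_zero (x : ∀ i, X i) :
    (C.channel x).map (Function.eval 0) =
      (C.interference fun i => x i.succ).map fun v => C.f (x 0, v) := by
  rw [channel_apply, Measure.map_map (g := Function.eval _) (measurable_pi_apply _)
    (C.measurable_assemble_right x), interference, Kernel.fst_apply,
    Measure.map_map (C.measurable_f_right _) measurable_fst]
  rfl

/-- The channel from the input to the output of user `0` for interference of law `v`. -/
def linkZero (v : Measure V) : Kernel (X 0) (Y 0) := (Kernel.id ×ₖ Kernel.const _ v).map C.f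

instance (v : Measure V) [IsProbabilityMeasure v] : IsMarkovKernel (C.linkZero v) :=
  Kernel.IsMarkovKernel.map _ C.measurable_f

lemma linkZero_apply (v : Measure V) [IsProbabilityMeasure v] (x : X 0) :
    C.linkZero v x = v.map fun v => C.f (x, v) := by
  rw [linkZero, Kernel.map_apply _ C.measurable_f, Kernel.prod_apply, Kernel.id_apply,
    Measure.dirac_prod, Measure.map_map C.measurable_f measurable_prodMk_left, Kernel.const_apply]
  rfl

lemma userLaw_apply_prod (p : ∀ i, ProbabilityMeasure (X i)) (i : Fin (n + 1)) {s : Set (X i)}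
    {t : Set (Y i)} (hs : MeasurableSet s) (ht : MeasurableSet t) :
    C.userLaw p i (s ×ˢ t) = ∫⁻ x, s.indicator 1 (x i) * (C.channel x).map (Function.eval i) t
      ∂(Measure.pi fun j => (p j : Measure (X j))) := by
  have hm : Measurable fun z : (∀ i, X i) × (∀ i, Y i) => (z.1 i, z.2 i) := by fun_prop
  rw [userLaw, Measure.map_apply hm (hs.prod ht), Measure.compProd_apply (hm (hs.prod ht))]
  refine lintegral_congr fun x => ?_
  rw [Measure.map_apply (measurable_pi_apply i) ht]
  by_cases hx : x i ∈ s
  · simp only [Set.indicator_of_mem hx, Pi.one_apply, one_mul]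
    congr 1
    ext y
    simp [hx]
  · simp only [Set.indicator_of_notMem hx, zero_mul]
    convert measure_empty (μ := C.channel x)
    ext y
    simp [hx]

lemma userLaw_succ (p : ∀ i, ProbabilityMeasure (X i)) (i : Fin n) :
    C.userLaw p i.succ = (p i.succ : Measure (X i.succ)) ⊗ₘ C.direct i := by
  have : IsFiniteMeasure (C.userLaw p i.succ) := by unfold userLaw; infer_instance
  refine Measure.ext_prod fun {s t} hs ht => ?_
  rw [userLaw_apply_prod C p _ hs ht, Measure.compProd_apply_prod hs ht, ← lintegral_indicator hs,
    ← (measurePreserving_eval (fun j => (p j : Measure (X j))) i.succ).map_eq,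
    lintegral_map (((C.direct i).measurable_coe ht).indicator hs) (measurable_pi_apply _)]
  refine lintegral_congr fun x => ?_
  rw [channel_map_succ]
  by_cases hx : x i.succ ∈ s <;> simp [hx]

/-- The law of the interference when the inputs are independent with laws `p`. -/
def interferenceLaw (p : ∀ i, ProbabilityMeasure (X i)) : Measure V :=
  C.interference ∘ₘ Measure.pi fun j : Fin n => (p j.succ : Measure (X j.succ))

instance (p : ∀ i, ProbabilityMeasure (X i)) : IsProbabilityMeasure (C.interferenceLaw p) := by
  unfold interferenceLaw; infer_instance

/-- The interference depends on the inputs of the other users only, so it is independent of the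
input of user `0` and acts as noise of a fixed law. -/
lemma userLaw_zero (p : ∀ i, ProbabilityMeasure (X i)) :
    C.userLaw p 0 = (p 0 : Measure (X 0)) ⊗ₘ C.linkZero (C.interferenceLaw p) := by
  have : IsFiniteMeasure (C.userLaw p 0) := by unfold userLaw; infer_instance
  refine Measure.ext_prod fun {s t} hs ht => ?_
  have hft : MeasurableSet (C.f ⁻¹' t) := C.measurable_f ht
  rw [userLaw_apply_prod C p _ hs ht, Measure.compProd_apply_prod hs ht, ← lintegral_indicator hs]
  set G : X 0 × (∀ j : Fin n, X j.succ) → ℝ≥0∞ := fun z =>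
    s.indicator 1 z.1 * C.interference z.2 {v | C.f (z.1, v) ∈ t} with hG
  have hGm : Measurable G := by
    refine ((measurable_one.indicator hs).comp measurable_fst).mul ?_
    exact Kernel.measurable_kernel_prodMk_left
      (κ := C.interference.comap Prod.snd (measurable_snd (α := X 0)))
      (t := {w : (X 0 × ∀ j : Fin n, X j.succ) × V | C.f (w.1.1, w.2) ∈ t})
      (hft.preimage ((measurable_fst.comp measurable_fst).prodMk measurable_snd))
  have h1 (x : ∀ i, X i) : s.indicator 1 (x 0) * (C.channel x).map (Function.eval 0) t =
      G (x 0, fun j => x j.succ) := by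
    rw [channel_map_zero, Measure.map_apply (C.measurable_f_right (x 0)) ht]
    rfl
  simp_rw [h1]
  rw [← lintegral_map hGm (g := fun x : ∀ i, X i => (x 0, fun j : Fin n => x j.succ))
    (by fun_prop), map_pi_succ, lintegral_prod _ hGm.aemeasurable]
  refine lintegral_congr fun x => ?_
  by_cases hx : x ∈ s
  · simp only [hG, Set.indicator_of_mem hx, Pi.one_apply, one_mul]
    rw [linkZero_apply, Measure.map_apply (C.measurable_f_right x) ht,
      interferenceLaw, Measure.bind_apply (C.measurable_f_right x ht)
        C.interference.aemeasurable]
    rfl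
  · simp [hG, hx]

end ManyToOneChannel

/-! ## Converse -/

namespace ManyToOneChannel

open InformationTheory

variable {n : ℕ} {X Y : Fin (n + 1) → Type*} {V : Type*}
  [∀ i, MeasurableSpace (X i)] [∀ i, MeasurableSpace (Y i)] [MeasurableSpace V]
  (C : ManyToOneChannel n X Y V)

section Code

variable {T : ℕ} {M : Fin (n + 1) → ℕ} (enc : ∀ i, Fin (M i) → Fin T → X i)

/-- The block channel from the message to the output of user `i.succ`. -/
def blockSucc (i : Fin n) : Kernel (Fin (M i.succ)) (Fin T → Y i.succ) :=
  (piKernel fun _ : Fin T => C.direct i).comap (enc i.succ) (measurable_of_countable _)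

instance (i : Fin n) : IsMarkovKernel (C.blockSucc enc i) := by
  unfold blockSucc; infer_instance

lemma blockSucc_apply (i : Fin n) (w : Fin (M i.succ)) :
    C.blockSucc enc i w = Measure.pi fun τ => C.direct i (enc i.succ w τ) := rfl

/-- The law of a block of interference when the messages are uniform. -/
def interferenceBlock : Measure (Fin T → V) :=
  (piKernel fun _ : Fin T => C.interference) ∘ₘ
    (Measure.pi fun j : Fin n => uniformFin (M j.succ)).map fun w τ j => enc j.succ (w j) τ

lemma measurable_blockInput (w : Fin (M 0)) :
    Measurable fun (v : Fin T → V) τ => C.f (enc 0 w τ, v τ) :=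
  measurable_pi_lambda _ fun τ => (C.measurable_f_right _).comp (measurable_pi_apply τ)

/-- The block channel from the message to the output of user `0`. -/
def blockZero : Kernel (Fin (M 0)) (Fin T → Y 0) where
  toFun w := (C.interferenceBlock enc).map fun v τ => C.f (enc 0 w τ, v τ)
  measurable' := measurable_of_countable _

lemma blockZero_apply (w : Fin (M 0)) :
    C.blockZero enc w = (C.interferenceBlock enc).map fun v τ => C.f (enc 0 w τ, v τ) := rfl

variable [∀ i, NeZero (M i)]

/-- The laws of the symbols sent at time `τ` when the messages are uniform. -/
def symbolLaw (τ : Fin T) (i : Fin (n + 1)) : ProbabilityMeasure (X i) :=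
  ⟨(uniformFin (M i)).map fun w => enc i w τ,
    Measure.isProbabilityMeasure_map (measurable_of_countable _).aemeasurable⟩

lemma symbolLaw_coe (τ : Fin T) (i : Fin (n + 1)) :
    (symbolLaw enc τ i : Measure (X i)) = (uniformFin (M i)).map fun w => enc i w τ := rfl

instance : IsProbabilityMeasure (C.interferenceBlock enc) := by
  have := Measure.isProbabilityMeasure_map
    (μ := Measure.pi fun j : Fin n => uniformFin (M j.succ))
    (f := fun w (τ : Fin T) (j : Fin n) => enc j.succ (w j) τ)
    (measurable_of_countable _).aemeasurable
  unfold interferenceBlock; infer_instance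

/-- At a single time the symbols of different users are independent because their messages are. Over
time the block need not be a product. -/
lemma interferenceBlock_map_eval (τ : Fin T) :
    (C.interferenceBlock enc).map (Function.eval τ) = C.interferenceLaw (symbolLaw enc τ) := by
  have h (j : Fin n) : IsProbabilityMeasure
      ((uniformFin (M j.succ)).map fun w => enc j.succ w τ) :=
    Measure.isProbabilityMeasure_map (measurable_of_countable _).aemeasurable
  rw [interferenceBlock, map_piKernel_comp_eval, interferenceLaw,
    Measure.map_map (measurable_pi_apply τ) (measurable_of_countable _)]
  simp_rw [symbolLaw_coe]
  rw [← Measure.pi_map_pi fun j => (measurable_of_countable _).aemeasurable]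
  rfl

instance : IsMarkovKernel (C.blockZero enc) :=
  ⟨fun w => Measure.isProbabilityMeasure_map (C.measurable_blockInput enc w).aemeasurable⟩

/-- The failure of one receiver is part of the error event and is decided by its own output alone,
so the dependence between outputs of different users plays no role. -/
lemma lintegral_marginal_error_le (dec : ∀ i, (Fin T → Y i) → Fin (M i))
    (hdec : ∀ i, Measurable (dec i)) (i : Fin (n + 1)) :
    ∫⁻ w, (Measure.pi fun τ => (C.channel fun j => enc j (w j) τ).map (Function.eval i))
      {y | dec i y ≠ w i} ∂(Measure.pi fun j => uniformFin (M j)) ≤ C.errorProb enc dec := by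
  rw [errorProb, ← lintegral_pi_uniformFin M]
  refine lintegral_mono fun w => ?_
  have hS : MeasurableSet {y | dec i y ≠ w i} :=
    (hdec i (measurableSet_singleton (w i))).compl
  have hp (τ : Fin T) : IsProbabilityMeasure
      ((C.channel fun j => enc j (w j) τ).map (Function.eval i)) :=
    Measure.isProbabilityMeasure_map (measurable_pi_apply i).aemeasurable
  rw [← Measure.pi_map_pi fun τ => (measurable_pi_apply i).aemeasurable,
    Measure.map_apply (by fun_prop) hS]
  exact measure_mono fun y hy => ⟨i, hy⟩

lemma measurableSet_error {M' : ℕ} {B : Type*} [MeasurableSpace B] {dec : B → Fin M'}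
    (hdec : Measurable dec) : MeasurableSet {z : Fin M' × B | dec z.2 ≠ z.1} :=
  (measurableSet_eq_fun (hdec.comp measurable_snd) measurable_fst).compl

lemma blockSucc_error_le (dec : ∀ i, (Fin T → Y i) → Fin (M i))
    (hdec : ∀ i, Measurable (dec i)) (i : Fin n) :
    (uniformFin (M i.succ) ⊗ₘ C.blockSucc enc i) {z | dec i.succ z.2 ≠ z.1} ≤
      C.errorProb enc dec := by
  refine le_trans (le_of_eq ?_) (C.lintegral_marginal_error_le enc dec hdec i.succ)
  rw [Measure.compProd_apply (measurableSet_error (hdec _)),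
    ← (measurePreserving_eval (fun j => uniformFin (M j)) i.succ).map_eq,
    lintegral_map (measurable_of_countable _) (measurable_pi_apply _)]
  refine lintegral_congr fun w => ?_
  simp_rw [channel_map_succ, blockSucc_apply]
  rfl

lemma blockZero_error_le (dec : ∀ i, (Fin T → Y i) → Fin (M i))
    (hdec : ∀ i, Measurable (dec i)) :
    (uniformFin (M 0) ⊗ₘ C.blockZero enc) {z | dec 0 z.2 ≠ z.1} ≤ C.errorProb enc dec := by
  refine le_trans (le_of_eq ?_) (C.lintegral_marginal_error_le enc dec hdec 0)
  set G : Fin (M 0) × (∀ j : Fin n, Fin (M j.succ)) → ℝ≥0∞ := fun z =>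
    (Measure.pi fun τ => C.interference fun j => enc j.succ (z.2 j) τ)
      {v | dec 0 (fun τ => C.f (enc 0 z.1 τ, v τ)) ≠ z.1} with hG
  have h1 (w : ∀ i, Fin (M i)) : (Measure.pi fun τ => (C.channel fun j => enc j (w j) τ).map
      (Function.eval 0)) {y | dec 0 y ≠ w 0} = G (w 0, fun j => w j.succ) := by
    have hS : MeasurableSet {y | dec 0 y ≠ w 0} :=
      (hdec 0 (measurableSet_singleton (w 0))).compl
    simp_rw [channel_map_zero]
    have hp (τ : Fin T) : IsProbabilityMeasure
        ((C.interference fun j => enc j.succ (w j.succ) τ).map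
        fun v => C.f (enc 0 (w 0) τ, v)) :=
      Measure.isProbabilityMeasure_map (C.measurable_f_right _).aemeasurable
    rw [← Measure.pi_map_pi fun τ => (C.measurable_f_right _).aemeasurable,
      Measure.map_apply (C.measurable_blockInput enc (w 0)) hS]
    rfl
  simp_rw [h1]
  rw [← lintegral_map (measurable_of_countable G)
    (g := fun w : ∀ i, Fin (M i) => (w 0, fun j : Fin n => w j.succ)) (by fun_prop), map_pi_succ,
    lintegral_prod _ (measurable_of_countable G).aemeasurable,
    Measure.compProd_apply (measurableSet_error (hdec _))]
  refine lintegral_congr fun w => ?_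
  have hS : MeasurableSet {y | dec 0 y ≠ w} := (hdec 0 (measurableSet_singleton w)).compl
  have h2 : Prod.mk w ⁻¹' {z : Fin (M 0) × (Fin T → Y 0) | dec 0 z.2 ≠ z.1} =
    {y | dec 0 y ≠ w} := rfl
  have hS' := C.measurable_blockInput enc w hS
  rw [h2, blockZero_apply, Measure.map_apply (C.measurable_blockInput enc w) hS, interferenceBlock,
    Measure.bind_apply hS' (Kernel.aemeasurable _),
    lintegral_map (Kernel.measurable_coe _ hS') (measurable_of_countable _)]
  rfl

/-- The law of the block of outputs of user `i.succ` when the messages are uniform. -/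
def outputSucc (i : Fin n) : Measure (Fin T → Y i.succ) :=
  C.blockSucc enc i ∘ₘ uniformFin (M i.succ)

instance (i : Fin n) : IsProbabilityMeasure (C.outputSucc enc i) := by
  unfold outputSucc; infer_instance

/-- Degradedness is applied at each time for fixed messages, and the average over the independent
messages is taken afterwards. The blocks on the right are independent over users by construction,
whatever the true joint law of the outputs is; only the law of the interference given the inputs
matters. -/
lemma interferenceBlock_eq_of_degraded (D : Kernel (∀ i : Fin n, Y i.succ) V) [IsMarkovKernel D]
    (hD : ∀ x : ∀ i : Fin n, X i.succ,
      C.interference x = (Measure.pi fun i => C.direct i (x i)).bind D) :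
    C.interferenceBlock enc = (piKernel fun _ : Fin T => D) ∘ₘ
      (Measure.pi fun i => C.outputSucc enc i).map fun y τ i => y i τ := by
  have hsw : Measurable fun (y : ∀ i : Fin n, Fin T → Y i.succ) τ i => y i τ := by fun_prop
  ext S hS
  have hDm := (piKernel fun _ : Fin T => D).measurable_coe hS
  unfold outputSucc
  rw [← piKernel_comp_pi, interferenceBlock, Measure.bind_apply hS (Kernel.aemeasurable _),
    Measure.bind_apply hS (Kernel.aemeasurable _),
    lintegral_map (Kernel.measurable_coe _ hS) (measurable_of_countable _),
    lintegral_map hDm hsw, Measure.lintegral_bind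
      (f := fun y : ∀ i : Fin n, Fin T → Y i.succ => (piKernel fun _ : Fin T => D) (fun τ i => y i τ) S)
      (Kernel.aemeasurable _)
      (hDm.comp hsw).aemeasurable]
  refine lintegral_congr fun w => ?_
  have hw : piKernel (C.blockSucc enc) w =
      Measure.pi fun i => Measure.pi fun τ => C.direct i (enc i.succ (w i) τ) := rfl
  rw [← lintegral_map hDm hsw, hw,
    map_pi_pi_swap (fun i τ => C.direct i (enc i.succ (w i) τ)),
    ← Measure.bind_apply hS (Kernel.aemeasurable _), piKernel_comp_pi, piKernel_apply]
  simp_rw [hD]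

/-- The law `v` and the product of its marginals are images, under the same memoryless kernel, of
the independent blocks `b i` and of the products of their marginals. Data processing and additivity
over users conclude. -/
lemma klDiv_degraded_block_le (D : Kernel (∀ i : Fin n, Y i.succ) V) [IsMarkovKernel D]
    (b : ∀ i : Fin n, Measure (Fin T → Y i.succ)) [∀ i, IsProbabilityMeasure (b i)]
    {v : Measure (Fin T → V)} (hv : v = (piKernel fun _ : Fin T => D) ∘ₘ
      (Measure.pi b).map fun y τ i => y i τ) :
    klDiv v (Measure.pi fun τ => v.map (Function.eval τ)) ≤
      ∑ i, klDiv (b i) (Measure.pi fun τ => (b i).map (Function.eval τ)) := by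
  have hsw : Measurable fun (y : ∀ i : Fin n, Fin T → Y i.succ) τ i => y i τ := by fun_prop
  have hb (i) (τ : Fin T) : IsProbabilityMeasure ((b i).map (Function.eval τ)) :=
    Measure.isProbabilityMeasure_map (measurable_pi_apply τ).aemeasurable
  have hbm (m : ∀ i : Fin n, Measure (Fin T → Y i.succ)) [∀ i, IsProbabilityMeasure (m i)] :
      IsProbabilityMeasure ((Measure.pi m).map fun y τ i => y i τ) :=
    Measure.isProbabilityMeasure_map hsw.aemeasurable
  have h1 : (Measure.pi fun τ => v.map (Function.eval τ)) = (piKernel fun _ : Fin T => D) ∘ₘ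
      (Measure.pi fun i => Measure.pi fun τ => (b i).map (Function.eval τ)).map
        fun y τ i => y i τ := by
    rw [map_pi_pi_swap (A := fun i : Fin n => Y i.succ) (fun i (τ : Fin T) =>
      (b i).map (Function.eval τ)), piKernel_comp_pi]
    congr 1
    ext1 τ
    rw [hv, map_piKernel_comp_eval, Measure.map_map (measurable_pi_apply τ) hsw,
      ← Measure.pi_map_pi fun i => (measurable_pi_apply τ).aemeasurable]
    rfl
  rw [h1]
  conv_lhs => rw [hv]
  have := hbm b
  have := hbm fun i => Measure.pi fun τ => (b i).map (Function.eval τ)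
  calc _ ≤ klDiv ((Measure.pi b).map fun y τ i => y i τ)
        ((Measure.pi fun i => Measure.pi fun τ => (b i).map (Function.eval τ)).map
          fun y τ i => y i τ) := klDiv_comp_right_le _ _ _
    _ ≤ klDiv (Measure.pi b) (Measure.pi fun i => Measure.pi fun τ =>
          (b i).map (Function.eval τ)) := klDiv_map_le _ _ hsw
    _ ≤ _ := klDiv_pi_pi_le _ _

lemma klDiv_symbol_le {i : Fin (n + 1)} {τ : Fin T} (κ : Kernel (X i) (Y i)) [IsMarkovKernel κ]
    {q : Measure (Y i)} (hq : q = κ ∘ₘ (symbolLaw enc τ i : Measure (X i))) :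
    klDiv (uniformFin (M i) ⊗ₘ κ.comap (fun w => enc i w τ) (measurable_of_countable _))
      ((uniformFin (M i)).prod q) ≤
      mutualInformation ((symbolLaw enc τ i : Measure (X i)) ⊗ₘ κ) := by
  have : IsProbabilityMeasure q := hq ▸ inferInstance
  rw [mutualInformation_compProd, ← hq, ← Measure.compProd_const, ← Measure.compProd_const]
  exact klDiv_compProd_comap_le (uniformFin (M i)) (φ := fun w => enc i w τ)
    (measurable_of_countable _) κ (Kernel.const _ _)

/-- In the golden formula the reference is the product of the output marginals. Given the message
the output block is already a product, so no dependence term appears on the right, while the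
dependence over time of the output is a loss on the left. This loss pays for user `0`. -/
lemma blockSucc_klDiv_le (i : Fin n) :
    klDiv (uniformFin (M i.succ) ⊗ₘ C.blockSucc enc i)
        ((uniformFin (M i.succ)).prod (C.outputSucc enc i)) +
      klDiv (C.outputSucc enc i)
        (Measure.pi fun τ => (C.outputSucc enc i).map (Function.eval τ)) ≤
      ∑ τ, C.userInfo (symbolLaw enc τ) i.succ := by
  have hb (τ : Fin T) : IsProbabilityMeasure ((C.outputSucc enc i).map (Function.eval τ)) :=
    Measure.isProbabilityMeasure_map (measurable_pi_apply τ).aemeasurable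
  refine (klDiv_compProd_add_klDiv_le _ _ _).trans ?_
  have hmap (w) (τ : Fin T) : (C.blockSucc enc i w).map (Function.eval τ) =
      C.direct i (enc i.succ w τ) := by
    rw [blockSucc_apply, (measurePreserving_eval _ τ).map_eq]
  refine (klDiv_compProd_pi_le _ _ _ 0 fun w => ?_).trans ?_
  · simp_rw [hmap, blockSucc_apply, klDiv_self]
    exact le_rfl
  rw [zero_add]
  refine Finset.sum_le_sum fun τ _ => ?_
  have hK : (C.blockSucc enc i).map (Function.eval τ) =
      (C.direct i).comap (fun w => enc i.succ w τ) (measurable_of_countable _) := by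
    ext1 w
    rw [Kernel.map_apply _ (measurable_pi_apply τ), hmap, Kernel.comap_apply]
  rw [hK, userInfo, userLaw_succ]
  refine klDiv_symbol_le enc _ ?_
  rw [outputSucc, Measure.map_comp _ _ (measurable_pi_apply τ), hK, symbolLaw_coe]
  ext S hS
  rw [Measure.bind_apply hS (Kernel.aemeasurable _), Measure.bind_apply hS (Kernel.aemeasurable _),
    lintegral_map (Kernel.measurable_coe _ hS) (measurable_of_countable _)]
  rfl

/-- Given the message, the output block is a coordinatewise image of the interference block, so its
dependence over time is at most that of the interference. -/
lemma blockZero_klDiv_le :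
    klDiv (uniformFin (M 0) ⊗ₘ C.blockZero enc)
        ((uniformFin (M 0)).prod (C.blockZero enc ∘ₘ uniformFin (M 0))) ≤
      klDiv (C.interferenceBlock enc)
        (Measure.pi fun τ => (C.interferenceBlock enc).map (Function.eval τ)) +
      ∑ τ, C.userInfo (symbolLaw enc τ) 0 := by
  set v := C.interferenceBlock enc with hv
  have hvp (τ : Fin T) : IsProbabilityMeasure (v.map (Function.eval τ)) :=
    Measure.isProbabilityMeasure_map (measurable_pi_apply τ).aemeasurable
  have hmap (w) (τ : Fin T) : (C.blockZero enc w).map (Function.eval τ) =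
      (v.map (Function.eval τ)).map fun v => C.f (enc 0 w τ, v) := by
    rw [blockZero_apply, Measure.map_map (measurable_pi_apply τ) (C.measurable_blockInput enc w),
      Measure.map_map (C.measurable_f_right _) (measurable_pi_apply τ)]
    rfl
  -- Golden formula with the product of the single-letter output laws as reference; the nonnegative
  -- divergence of the true output from it is discarded.
  refine le_self_add.trans ((klDiv_compProd_add_klDiv_le _ _ (Measure.pi fun τ =>
    C.linkZero (v.map (Function.eval τ)) ∘ₘ (symbolLaw enc τ 0 : Measure (X 0)))).trans ?_)
  refine (klDiv_compProd_pi_le _ _ _ _ fun w => ?_).trans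
    (add_le_add_right (Finset.sum_le_sum fun τ _ => ?_) _)
  · simp_rw [hmap]
    have hp (τ : Fin T) : IsProbabilityMeasure
        ((v.map (Function.eval τ)).map fun v => C.f (enc 0 w τ, v)) :=
      Measure.isProbabilityMeasure_map (C.measurable_f_right _).aemeasurable
    rw [← Measure.pi_map_pi fun τ => (C.measurable_f_right _).aemeasurable, blockZero_apply]
    exact klDiv_map_le _ _ (C.measurable_blockInput enc w)
  · have hK : (C.blockZero enc).map (Function.eval τ) =
        (C.linkZero (v.map (Function.eval τ))).comap (fun w => enc 0 w τ)
          (measurable_of_countable _) := by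
      ext1 w
      rw [Kernel.map_apply _ (measurable_pi_apply τ), hmap, Kernel.comap_apply, linkZero_apply]
    have hl : v.map (Function.eval τ) = C.interferenceLaw (symbolLaw enc τ) :=
      C.interferenceBlock_map_eval enc τ
    rw [hK, userInfo, userLaw_zero, ← hl]
    exact klDiv_symbol_le enc _ rfl

end Code

end ManyToOneChannel

/-! ### Converse: from block informations to rates -/

namespace ManyToOneChannel

open InformationTheory Real

variable {n : ℕ} {X Y : Fin (n + 1) → Type*} {V : Type*}
  [∀ i, MeasurableSpace (X i)] [∀ i, MeasurableSpace (Y i)] [MeasurableSpace V]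
  (C : ManyToOneChannel n X Y V)

/-- The converse for one code. -/
lemma sum_log_card_le (hC : C.IsDegraded) {S : ℝ≥0∞} (hS : S ≠ ∞)
    (hI : ∀ p : ∀ i, ProbabilityMeasure (X i), ∑ i, C.userInfo p i ≤ S)
    {T : ℕ} {M : Fin (n + 1) → ℕ} [∀ i, NeZero (M i)] (enc : ∀ i, Fin (M i) → Fin T → X i)
    (dec : ∀ i, (Fin T → Y i) → Fin (M i)) (hdec : ∀ i, Measurable (dec i)) {s ε : ℝ}
    (hs : 0 < s) (hs' : s ≤ 1 / 2) (hε : 0 ≤ ε)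
    (herr : C.errorProb enc dec ≤ ENNReal.ofReal ε) :
    ∑ i, ((1 - ε) * (log (M i) + log (1 - s)) + ε * log s) ≤ T * S.toReal := by
  obtain ⟨D, hDM, hD⟩ := hC
  set J0 := klDiv (uniformFin (M 0) ⊗ₘ C.blockZero enc)
    ((uniformFin (M 0)).prod (C.blockZero enc ∘ₘ uniformFin (M 0))) with hJ0
  set J : Fin n → ℝ≥0∞ := fun i => klDiv (uniformFin (M i.succ) ⊗ₘ C.blockSucc enc i)
    ((uniformFin (M i.succ)).prod (C.outputSucc enc i)) with hJ
  have hsum : J0 + ∑ i, J i ≤ T * S := by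
    calc J0 + ∑ i, J i
        ≤ (∑ i, klDiv (C.outputSucc enc i)
            (Measure.pi fun τ => (C.outputSucc enc i).map (Function.eval τ)) +
          ∑ τ, C.userInfo (symbolLaw enc τ) 0) + ∑ i, J i := by
          gcongr
          refine (C.blockZero_klDiv_le enc).trans ?_
          gcongr
          exact klDiv_degraded_block_le D _ (C.interferenceBlock_eq_of_degraded enc D hD)
      -- The gain of user `0` is redistributed: each other user absorbs the dependence over time of
      -- its own output.
      _ = ∑ τ, C.userInfo (symbolLaw enc τ) 0 + ∑ i, (J i + klDiv (C.outputSucc enc i)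
            (Measure.pi fun τ => (C.outputSucc enc i).map (Function.eval τ))) := by
          rw [Finset.sum_add_distrib]; ring
      _ ≤ ∑ τ, C.userInfo (symbolLaw enc τ) 0 +
          ∑ i : Fin n, ∑ τ, C.userInfo (symbolLaw enc τ) i.succ := by
          gcongr with i
          exact C.blockSucc_klDiv_le enc i
      _ = ∑ τ, ∑ i, C.userInfo (symbolLaw enc τ) i := by
          simp_rw [Fin.sum_univ_succ, Finset.sum_add_distrib]
          rw [Finset.sum_comm]
      _ ≤ ∑ _τ : Fin T, S := Finset.sum_le_sum fun τ _ => hI _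
      _ = T * S := by simp
  have hTS : (T : ℝ≥0∞) * S ≠ ∞ := ENNReal.mul_ne_top (by simp) hS
  have hfin : J0 + ∑ i, J i ≠ ∞ := ne_top_of_le_ne_top hTS hsum
  have hfin0 : J0 ≠ ∞ := (ENNReal.add_ne_top.1 hfin).1
  have hfinJ (i) : J i ≠ ∞ :=
    ENNReal.sum_ne_top.1 (ENNReal.add_ne_top.1 hfin).2 i (Finset.mem_univ i)
  have h := ENNReal.toReal_mono hTS hsum
  rw [ENNReal.toReal_add hfin0 (ENNReal.add_ne_top.1 hfin).2,
    ENNReal.toReal_sum fun i _ => hfinJ i, ENNReal.toReal_mul, ENNReal.toReal_natCast] at h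
  refine le_trans ?_ h
  rw [Fin.sum_univ_succ]
  refine add_le_add ?_ (Finset.sum_le_sum fun i _ => ?_)
  · exact fano _ _ (hdec 0) hs hs' hε ((C.blockZero_error_le enc dec hdec).trans herr) hfin0
  · exact fano _ _ (hdec i.succ) hs hs' hε ((C.blockSucc_error_le enc dec hdec i).trans herr)
      (hfinJ i)

/-- The converse: rates sustained with vanishing error probability have a sum of at most the
largest sum of single-letter informations. -/
theorem sum_rate_le (hC : C.IsDegraded) {S : ℝ≥0∞}
    (hI : ∀ p : ∀ i, ProbabilityMeasure (X i), ∑ i, C.userInfo p i ≤ S)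
    {R : Fin (n + 1) → ℝ} {T : ℕ → ℕ} {M : ℕ → Fin (n + 1) → ℕ}
    (enc : ∀ k i, Fin (M k i) → Fin (T k) → X i)
    (dec : ∀ k i, (Fin (T k) → Y i) → Fin (M k i)) (hT : ∀ k, 0 < T k) (hM : ∀ k i, 0 < M k i)
    (hdec : ∀ k i, Measurable (dec k i)) (hR : ∀ k i, R i ≤ Real.log (M k i) / T k)
    (hlim : Tendsto (fun k => C.errorProb (enc k) (dec k)) atTop (𝓝 0)) :
    ENNReal.ofReal (∑ i, R i) ≤ S := by
  rcases eq_or_ne S ∞ with rfl | hS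
  · exact le_top
  refine ENNReal.ofReal_le_of_le_toReal ?_
  have hlim' : Tendsto (fun k => (C.errorProb (enc k) (dec k)).toReal) atTop (𝓝 0) :=
    (ENNReal.tendsto_toReal ENNReal.zero_ne_top).comp hlim
  have key (s : ℝ) (hs : 0 < s) (hs' : s ≤ 1 / 2) :
      ∑ i, (R i + log (1 - s)) ≤ S.toReal := by
    have hlog1 : log (1 - s) ≤ 0 := Real.log_nonpos (by linarith) (by linarith)
    have hlog2 : log s ≤ 0 := Real.log_nonpos hs.le (by linarith)
    have h1 : ∀ᶠ k in atTop, ∑ i, ((1 - (C.errorProb (enc k) (dec k)).toReal) *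
        (R i + log (1 - s)) + (C.errorProb (enc k) (dec k)).toReal * log s) ≤ S.toReal := by
      filter_upwards [hlim'.eventually_le_const one_pos,
        hlim.eventually_lt_const ENNReal.zero_lt_top]
        with k hk1 hk2
      have hNZ : ∀ i, NeZero (M k i) := fun i => ⟨(hM k i).ne'⟩
      have hT0 : (1 : ℝ) ≤ T k := by exact_mod_cast hT k
      have hT1 : (0 : ℝ) < T k := by linarith
      have h2 := C.sum_log_card_le hC hS hI (enc k) (dec k) (hdec k) hs hs'
        ENNReal.toReal_nonneg (ENNReal.ofReal_toReal hk2.ne).ge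
      rw [mul_comm (T k : ℝ), ← div_le_iff₀ hT1, Finset.sum_div] at h2
      refine (Finset.sum_le_sum fun i _ => ?_).trans h2
      rw [le_div_iff₀ hT1]
      set ε := (C.errorProb (enc k) (dec k)).toReal
      have hε : 0 ≤ ε := ENNReal.toReal_nonneg
      have h3 := hR k i
      rw [le_div_iff₀ hT1] at h3
      have h4 : (1 - ε) * (R i * T k) ≤ (1 - ε) * log (M k i) :=
        mul_le_mul_of_nonneg_left h3 (by linarith)
      -- As `T ≥ 1` and the logarithms are nonpositive, dividing them by `T` can only increase them.
      -- Hence the block lengths need not tend to infinity.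
      have h5 : (1 - ε) * log (1 - s) * T k ≤ (1 - ε) * log (1 - s) := by
        have : (1 - ε) * log (1 - s) ≤ 0 := mul_nonpos_of_nonneg_of_nonpos (by linarith) hlog1
        nlinarith
      have h6 : ε * log s * T k ≤ ε * log s := by
        have : ε * log s ≤ 0 := mul_nonpos_of_nonneg_of_nonpos hε hlog2
        nlinarith
      linarith
    have h2 : Tendsto (fun k => ∑ i, ((1 - (C.errorProb (enc k) (dec k)).toReal) *
        (R i + log (1 - s)) + (C.errorProb (enc k) (dec k)).toReal * log s)) atTop
        (𝓝 (∑ i, ((1 - 0) * (R i + log (1 - s)) + 0 * log s))) :=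
      tendsto_finsetSum _ fun i _ =>
        ((tendsto_const_nhds.sub hlim').mul_const _).add (hlim'.mul_const _)
    simpa using le_of_tendsto h2 h1
  -- The parameter of Fano's inequality tends to `0` only after the error probability has vanished.
  have h3 : Tendsto (fun s : ℝ => ∑ i, (R i + log (1 - s))) (𝓝[>] 0)
      (𝓝 (∑ i, (R i + log (1 - 0)))) := by
    refine tendsto_finsetSum _ fun i _ => tendsto_const_nhds.add ?_
    refine tendsto_nhdsWithin_of_tendsto_nhds (ContinuousAt.tendsto ?_)
    exact (continuousAt_const.sub continuousAt_id).log (by norm_num)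
  simp only [sub_zero, log_one, add_zero] at h3
  refine le_of_tendsto h3 ?_
  filter_upwards [self_mem_nhdsWithin,
    mem_nhdsWithin_of_mem_nhds (Iic_mem_nhds (by norm_num : (0 : ℝ) < 1 / 2))] with s hs hs'
    using key s hs hs'

theorem sum_rate_le_of_mem_capacityRegion (hC : C.IsDegraded) {S : ℝ≥0∞}
    (hI : ∀ p : ∀ i, ProbabilityMeasure (X i), ∑ i, C.userInfo p i ≤ S)
    {R : Fin (n + 1) → ℝ} (hR : R ∈ C.capacityRegion) : ENNReal.ofReal (∑ i, R i) ≤ S := by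
  have hcl : IsClosed {R : Fin (n + 1) → ℝ | ENNReal.ofReal (∑ i, R i) ≤ S} :=
    isClosed_le (ENNReal.continuous_ofReal.comp (by fun_prop)) continuous_const
  refine closure_minimal ?_ hcl hR
  rintro R ⟨T, M, enc, dec, hT, hM, hdec, hRM, hlim⟩
  exact C.sum_rate_le hC hI enc dec hT hM hdec (fun k i => (hRM k i).le) hlim

end ManyToOneChannel

/-! ## Likelihood ratios and typicality -/

section LikelihoodRatio

open InformationTheory Real

variable {A B : Type*} [MeasurableSpace A] [MeasurableSpace B] {Ω : Type*} [MeasurableSpace Ω]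

/-- This is the derivative of `s ↦ r ^ (1 - s)` at `0`. It links power moments of the density, which
govern the Chernoff bound, with the divergence. -/
lemma tendsto_tsallis_klFun {r : ℝ} (hr : 0 ≤ r) :
    Tendsto (fun s : ℝ => (r - r ^ (1 - s)) / s + 1 - r) (𝓝[>] 0) (𝓝 (klFun r)) := by
  rcases hr.eq_or_lt with rfl | hr
  · rw [klFun_zero]
    refine tendsto_const_nhds.congr' ?_
    filter_upwards [self_mem_nhdsWithin,
      mem_nhdsWithin_of_mem_nhds (Iio_mem_nhds (zero_lt_one' ℝ))] with s hs hs'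
    rw [Real.zero_rpow (by have : s < 1 := hs'; linarith)]
    simp
  · have h1 : HasDerivAt (fun s : ℝ => r ^ (1 - s)) (-(r * log r)) 0 := by
      have := (Real.hasStrictDerivAt_const_rpow hr (1 - 0)).hasDerivAt.comp 0
        ((hasDerivAt_id (0 : ℝ)).const_sub 1)
      simpa [Function.comp_def] using this
    have h2 := h1.tendsto_slope_zero_right
    rw [klFun_apply]
    have h3 : Tendsto (fun s : ℝ => -(s⁻¹ • (r ^ (1 - (0 + s)) - r ^ (1 - (0 : ℝ)))) + 1 - r)
        (𝓝[>] 0) (𝓝 (-(-(r * log r)) + 1 - r)) := (h2.neg.add_const 1).sub_const r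
    rw [neg_neg] at h3
    refine h3.congr fun s => ?_
    simp only [zero_add, sub_zero, Real.rpow_one, smul_eq_mul]
    ring

lemma tsallis_nonneg {r s : ℝ} (hr : 0 ≤ r) (hs : 0 < s) (hs' : s < 1) :
    0 ≤ (r - r ^ (1 - s)) / s + 1 - r := by
  have h := Real.geom_mean_le_arith_mean2_weighted (w₁ := 1 - s) (w₂ := s) (by linarith) hs.le
    hr zero_le_one (by ring)
  rw [Real.one_rpow, mul_one, mul_one] at h
  have h2 : r - 1 ≤ (r - r ^ (1 - s)) / s := by
    rw [le_div_iff₀ hs]; linarith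
  linarith

/-- Chernoff-type estimate in the absolutely continuous case. -/
lemma exists_lintegral_rpow_lt_of_ac {P Q : Measure Ω} [IsProbabilityMeasure P]
    [IsProbabilityMeasure Q] (hPQ : P ≪ Q) {γ : ℝ} (hγ : ENNReal.ofReal γ < klDiv P Q) :
    ∃ s : ℝ, 0 < s ∧ s < 1 ∧
      ∫⁻ x, ((P.rnDeriv Q x)⁻¹) ^ s ∂P < ENNReal.ofReal (exp (-(s * γ))) := by
  -- If no `s` works, then `∫ r ^ (1 - s) ∂Q ≥ exp (-(s * γ)) ≥ 1 - s * γ` for all `s` in `(0, 1)`,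
  -- where `r = dP/dQ`. So the approximations of the divergence from `tendsto_tsallis_klFun` have
  -- integral at most `γ`, and Fatou's lemma as `s → 0` bounds the divergence itself. Infinite
  -- divergence needs no separate treatment.
  by_contra! hcon
  refine hγ.not_ge ?_
  rw [klDiv_eq_lintegral_klFun_of_ac hPQ]
  set r : Ω → ℝ := fun x => (P.rnDeriv Q x).toReal with hr
  have hrm : Measurable r := (Measure.measurable_rnDeriv P Q).ennreal_toReal
  have hr0 (x) : 0 ≤ r x := ENNReal.toReal_nonneg
  have hri : Integrable r Q := Measure.integrable_toReal_rnDeriv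
  have hr1 : ∫ x, r x ∂Q = 1 := by
    have := Measure.integral_toReal_rnDeriv hPQ
    simpa using this
  have hbound (s : ℝ) (hs : 0 < s) (hs' : s < 1) :
      ∫⁻ x, ENNReal.ofReal ((r x - r x ^ (1 - s)) / s + 1 - r x) ∂Q ≤ ENNReal.ofReal γ := by
    have hpi : Integrable (fun x => r x ^ (1 - s)) Q := by
      refine Integrable.mono' ((hri.const_mul (1 - s)).add (integrable_const s))
        (hrm.pow_const _).aestronglyMeasurable (ae_of_all _ fun x => ?_)
      have h := Real.geom_mean_le_arith_mean2_weighted (w₁ := 1 - s) (w₂ := s) (by linarith) hs.le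
        (hr0 x) zero_le_one (by ring)
      rw [Real.one_rpow, mul_one, mul_one] at h
      rw [Real.norm_of_nonneg (Real.rpow_nonneg (hr0 x) _)]
      exact h
    have hint : Integrable (fun x => (r x - r x ^ (1 - s)) / s + 1 - r x) Q :=
      (((hri.sub hpi).div_const s).add (integrable_const 1)).sub hri
    rw [← ofReal_integral_eq_lintegral_ofReal hint
      (ae_of_all _ fun x => tsallis_nonneg (hr0 x) hs hs')]
    refine ENNReal.ofReal_le_ofReal ?_
    have h1 : ∫ x, ((r x - r x ^ (1 - s)) / s + 1 - r x) ∂Q =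
        (1 - ∫ x, r x ^ (1 - s) ∂Q) / s := by
      rw [integral_sub (f := fun x => (r x - r x ^ (1 - s)) / s + 1) (g := r)
          (((hri.sub hpi).div_const s).add (integrable_const 1)) hri,
        integral_add (f := fun x => (r x - r x ^ (1 - s)) / s) (g := fun _ => 1)
          ((hri.sub hpi).div_const s) (integrable_const 1), integral_div,
        integral_sub hri hpi, hr1]
      simp
    have h2 : exp (-(s * γ)) ≤ ∫ x, r x ^ (1 - s) ∂Q := by
      have h3 : ∫⁻ x, ((P.rnDeriv Q x)⁻¹) ^ s ∂P = ENNReal.ofReal (∫ x, r x ^ (1 - s) ∂Q) := by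
        rw [ofReal_integral_eq_lintegral_ofReal hpi
          (ae_of_all _ fun x => Real.rpow_nonneg (hr0 x) _),
          ← lintegral_rnDeriv_mul hPQ (by fun_prop)]
        refine lintegral_congr_ae ?_
        filter_upwards [Measure.rnDeriv_lt_top P Q] with x hx
        by_cases h0 : P.rnDeriv Q x = 0
        · have : r x = 0 := by simp [hr, h0]
          simp [h0, this, Real.zero_rpow (by linarith : 1 - s ≠ 0)]
        · rw [← ENNReal.ofReal_rpow_of_nonneg (hr0 x) (by linarith), hr,
            ENNReal.ofReal_toReal hx.ne, ENNReal.inv_rpow, ← ENNReal.rpow_neg, sub_eq_add_neg,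
            ENNReal.rpow_add _ _ h0 hx.ne, ENNReal.rpow_one]
      have h4 := hcon s hs hs'
      rw [h3] at h4
      exact (ENNReal.ofReal_le_ofReal_iff
        (integral_nonneg fun x => Real.rpow_nonneg (hr0 x) _)).1 h4
    rw [h1, div_le_iff₀ hs]
    have := Real.add_one_le_exp (-(s * γ))
    linarith
  set u : ℕ → ℝ := fun k => 1 / ((k : ℝ) + 2) with hu
  have hu0 (k) : 0 < u k := by positivity
  have hu1 (k) : u k < 1 := by
    rw [hu, div_lt_one (by positivity)]
    have : (0 : ℝ) ≤ k := by positivity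
    linarith
  have hut : Tendsto u atTop (𝓝[>] 0) := by
    refine tendsto_nhdsWithin_iff.2 ⟨?_, Eventually.of_forall fun k => hu0 k⟩
    exact tendsto_const_nhds.div_atTop (tendsto_natCast_atTop_atTop.atTop_add tendsto_const_nhds)
  calc ∫⁻ x, ENNReal.ofReal (klFun (P.rnDeriv Q x).toReal) ∂Q
      = ∫⁻ x, liminf (fun k => ENNReal.ofReal ((r x - r x ^ (1 - u k)) / u k + 1 - r x))
          atTop ∂Q := by
        refine lintegral_congr fun x => ?_
        exact ((ENNReal.continuous_ofReal.tendsto _).comp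
          ((tendsto_tsallis_klFun (hr0 x)).comp hut)).liminf_eq.symm
    _ ≤ liminf (fun k => ∫⁻ x, ENNReal.ofReal ((r x - r x ^ (1 - u k)) / u k + 1 - r x) ∂Q)
          atTop := by
        refine lintegral_liminf_le fun k => ENNReal.measurable_ofReal.comp ?_
        fun_prop
    _ ≤ ENNReal.ofReal γ := by
        refine liminf_le_of_le (by isBoundedDefault) fun b hb => ?_
        obtain ⟨k, hk⟩ := hb.exists
        exact hk.trans (hbound _ (hu0 k) (hu1 k))

lemma ENNReal_rpow_le_one_add {x : ℝ≥0∞} {s : ℝ} (hs : 0 < s) (hs' : s ≤ 1) :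
    x ^ s ≤ 1 + ENNReal.ofReal s * x := by
  rcases eq_or_ne x ∞ with rfl | hx
  · rw [ENNReal.mul_top (by simpa using hs)]; simp
  lift x to NNReal using hx
  have h := rpow_one_add_le_one_add_mul_self (s := x - 1)
    (by have := x.2; linarith) hs.le hs'
  rw [add_sub_cancel] at h
  have h2 : ((x : ℝ) ^ s) ≤ 1 + s * x := by linarith
  have h3 := ENNReal.ofReal_le_ofReal h2
  rwa [← ENNReal.ofReal_rpow_of_nonneg x.coe_nonneg hs.le, ENNReal.ofReal_coe_nnreal,
    ENNReal.ofReal_add zero_le_one (by positivity), ENNReal.ofReal_mul hs.le,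
    ENNReal.ofReal_coe_nnreal, ENNReal.ofReal_one] at h3

variable (P : Measure (A × B))

lemma measurable_likelihoodRatio : Measurable (likelihoodRatio P) :=
  (Measure.measurable_rnDeriv _ _).div (Measure.measurable_rnDeriv _ _)

lemma measurable_inv_likelihoodRatio : Measurable fun z => (likelihoodRatio P z)⁻¹ :=
  (measurable_likelihoodRatio P).inv

lemma measurableSet_isTypical (γ : ℝ) (T : ℕ) :
    MeasurableSet {z : (Fin T → A) × (Fin T → B) | IsTypical P γ z.1 z.2} := by
  refine measurableSet_lt measurable_const (Finset.measurable_prod _ fun τ _ => ?_)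
  exact (measurable_likelihoodRatio P).comp (by fun_prop)

variable [IsProbabilityMeasure P]

lemma likelihoodRatio_ae_eq :
    likelihoodRatio P =ᵐ[P.fst.prod P.snd] P.rnDeriv (P.fst.prod P.snd) :=
  (Measure.rnDeriv_eq_div_rnDeriv_add _ _).symm

lemma lintegral_likelihoodRatio_le : ∫⁻ z, likelihoodRatio P z ∂(P.fst.prod P.snd) ≤ 1 := by
  rw [lintegral_congr_ae (likelihoodRatio_ae_eq P)]
  exact (Measure.lintegral_rnDeriv_le).trans_eq measure_univ

/-- The density of `P` with respect to `P + Q` is positive and finite `P`-almost everywhere, so the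
quotient can be inverted even where `P` is singular to `Q`. -/
lemma inv_likelihoodRatio_ae_eq :
    ∀ᵐ z ∂P, likelihoodRatio P z ≠ 0 ∧
      (likelihoodRatio P z)⁻¹ = (P.fst.prod P.snd).rnDeriv P z := by
  set Q := P.fst.prod P.snd
  have hac : P ≪ P + Q := rfl.absolutelyContinuous.add_right _
  have h := Measure.rnDeriv_eq_div_rnDeriv_add Q P
  rw [add_comm] at h
  filter_upwards [h, Measure.rnDeriv_pos hac, hac (Measure.rnDeriv_lt_top P (P + Q)),
    hac (Measure.rnDeriv_lt_top Q (P + Q))] with z h1 h2 h3 h4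
  refine ⟨ENNReal.div_ne_zero.2 ⟨h2.ne', h4.ne⟩, ?_⟩
  rw [h1, likelihoodRatio, ENNReal.inv_div (Or.inr h3.ne) (Or.inr h2.ne')]

/-- Chernoff-type estimate for the information density. -/
lemma exists_lintegral_inv_likelihoodRatio_rpow_lt {γ : ℝ}
    (hγ : ENNReal.ofReal γ < mutualInformation P) :
    ∃ s : ℝ, 0 < s ∧ ∫⁻ z, ((likelihoodRatio P z)⁻¹) ^ s ∂P < ENNReal.ofReal (exp (-(s * γ))) := by
  rw [mutualInformation] at hγ
  set Q := P.fst.prod P.snd with hQ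
  by_cases hac : P ≪ Q
  · obtain ⟨s, hs, -, h⟩ := exists_lintegral_rpow_lt_of_ac hac hγ
    refine ⟨s, hs, ?_⟩
    rwa [lintegral_congr_ae (g := fun z => ((P.rnDeriv Q z)⁻¹) ^ s)]
    filter_upwards [hac (likelihoodRatio_ae_eq P)] with z hz
    rw [hz]
  -- A singular part makes the information infinite, and it also makes the estimate easy: on `E` the
  -- inverse ratio vanishes, elsewhere its power is at most `1 + s` times itself. The integral is at
  -- most `P Eᶜ + s`, whose limit `P Eᶜ < 1` as `s → 0` lies below that of `exp (-(s * γ))`.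
  · obtain ⟨E, hE, hQE, hPE⟩ : ∃ E, MeasurableSet E ∧ Q E = 0 ∧ P E ≠ 0 := by
      by_contra! hcon
      exact hac (Measure.AbsolutelyContinuous.mk hcon)
    have h0 : ∀ᵐ z ∂P, z ∈ E → (likelihoodRatio P z)⁻¹ = 0 := by
      have h1 : ∫⁻ z in E, Q.rnDeriv P z ∂P = 0 := le_antisymm
        ((Measure.setLIntegral_rnDeriv_le E).trans_eq hQE) (zero_le)
      rw [lintegral_eq_zero_iff (Measure.measurable_rnDeriv _ _), Filter.EventuallyEq,
        ae_restrict_iff' hE] at h1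
      filter_upwards [h1, inv_likelihoodRatio_ae_eq P] with z hz hz' hzE
      rw [hz'.2, hz hzE]; rfl
    have hle : ∫⁻ z, (likelihoodRatio P z)⁻¹ ∂P ≤ 1 := by
      rw [lintegral_congr_ae ((inv_likelihoodRatio_ae_eq P).mono fun z hz => hz.2)]
      exact (Measure.lintegral_rnDeriv_le).trans_eq measure_univ
    have hPlt : P.real Eᶜ < 1 := by
      have h2 := probReal_add_probReal_compl (μ := P) hE
      have h3 : 0 < P.real E := ENNReal.toReal_pos hPE (measure_ne_top _ _)
      linarith
    have hev : ∀ᶠ s : ℝ in 𝓝[>] 0, P.real Eᶜ + s < exp (-(s * γ)) := by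
      have h1 : Tendsto (fun s : ℝ => P.real Eᶜ + s) (𝓝[>] 0) (𝓝 (P.real Eᶜ + 0)) :=
        tendsto_nhdsWithin_of_tendsto_nhds (Continuous.tendsto (by fun_prop) 0)
      have h2 : Tendsto (fun s : ℝ => exp (-(s * γ))) (𝓝[>] 0) (𝓝 (exp (-(0 * γ)))) :=
        tendsto_nhdsWithin_of_tendsto_nhds
          (Continuous.tendsto (f := fun s : ℝ => exp (-(s * γ))) (by fun_prop) 0)
      exact h1.eventually_lt h2 (by simpa using hPlt)
    obtain ⟨s, hs, hs0, hs1⟩ := (hev.and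
      ((eventually_mem_nhdsWithin (a := (0 : ℝ)) (s := Set.Ioi 0)).and
      (mem_nhdsWithin_of_mem_nhds (Iic_mem_nhds (zero_lt_one' ℝ))))).exists
    have hs0 : 0 < s := hs0
    refine ⟨s, hs0, lt_of_le_of_lt ?_ ((ENNReal.ofReal_lt_ofReal_iff (exp_pos _)).2 hs)⟩
    calc ∫⁻ z, ((likelihoodRatio P z)⁻¹) ^ s ∂P
        ≤ ∫⁻ z, (Eᶜ.indicator 1 z + ENNReal.ofReal s * (likelihoodRatio P z)⁻¹) ∂P := by
          refine lintegral_mono_ae ?_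
          filter_upwards [h0] with z hz
          by_cases hzE : z ∈ E
          · simp [hz hzE, hzE, hs0]
          · simpa [hzE] using ENNReal_rpow_le_one_add hs0 hs1
      _ = P Eᶜ + ENNReal.ofReal s * ∫⁻ z, (likelihoodRatio P z)⁻¹ ∂P := by
          rw [lintegral_add_left (measurable_one.indicator hE.compl),
            lintegral_indicator_one hE.compl,
            lintegral_const_mul _ (measurable_inv_likelihoodRatio P)]
      _ ≤ ENNReal.ofReal (P.real Eᶜ + s) := by
          rw [ENNReal.ofReal_add measureReal_nonneg hs0.le, ofReal_measureReal]
          gcongr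
          exact mul_le_of_le_one_right (zero_le) hle

/-- Markov's inequality for the product of likelihood ratios, whose mean under the product law is at
most `1`. It bounds the chance that one wrong codeword looks typical. -/
lemma pi_prod_isTypical_le (γ : ℝ) (T : ℕ) :
    (Measure.pi fun _ : Fin T => P.fst.prod P.snd)
      {z | IsTypical P γ (fun τ => (z τ).1) (fun τ => (z τ).2)} ≤
      ENNReal.ofReal (exp (-(T * γ))) := by
  have hL := measurable_likelihoodRatio P
  have h := mul_meas_ge_le_lintegral (μ := Measure.pi fun _ : Fin T => P.fst.prod P.snd)
    (f := fun z => ∏ τ, likelihoodRatio P (z τ))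
    (Finset.measurable_prod _ fun τ _ => hL.comp (measurable_pi_apply τ))
    (ENNReal.ofReal (exp (T * γ)))
  rw [lintegral_pi_prod_eq_prod _ fun _ => hL] at h
  have h1 := h.trans (Finset.prod_le_one (fun _ _ => zero_le)
    fun _ _ => lintegral_likelihoodRatio_le P)
  rw [mul_comm, ← ENNReal.le_div_iff_mul_le (Or.inl (by simp [exp_pos])) (Or.inl (by simp))] at h1
  refine (measure_mono ?_).trans (h1.trans_eq ?_)
  · intro z hz
    have hz' : ENNReal.ofReal (exp (T * γ)) < ∏ τ, likelihoodRatio P (z τ) := hz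
    exact hz'.le
  · rw [one_div, ← ENNReal.ofReal_inv_of_pos (exp_pos _), ← Real.exp_neg]

/-- Markov's inequality for the power `-s` of the product of likelihood ratios. -/
lemma pi_not_isTypical_le (γ : ℝ) (T : ℕ) {s : ℝ} (hs : 0 < s) :
    (Measure.pi fun _ : Fin T => P)
      {z | ¬ IsTypical P γ (fun τ => (z τ).1) (fun τ => (z τ).2)} ≤
      (ENNReal.ofReal (exp (s * γ)) * ∫⁻ z, ((likelihoodRatio P z)⁻¹) ^ s ∂P) ^ T := by
  have hL := measurable_likelihoodRatio P
  have hLs : Measurable fun z => ((likelihoodRatio P z)⁻¹) ^ s :=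
    (measurable_inv_likelihoodRatio P).pow_const _
  set E : ℝ≥0∞ := ENNReal.ofReal (exp (T * γ)) with hE
  have hE0 : E ≠ 0 := by simp [hE, exp_pos]
  have h := mul_meas_ge_le_lintegral (μ := Measure.pi fun _ : Fin T => P)
    (f := fun z => ∏ τ, ((likelihoodRatio P (z τ))⁻¹) ^ s)
    (Finset.measurable_prod _ fun τ _ => hLs.comp (measurable_pi_apply τ)) (E⁻¹ ^ s)
  rw [lintegral_pi_prod_eq_prod _ fun _ => hLs, Finset.prod_const, Finset.card_univ,
    Fintype.card_fin, mul_comm, ← ENNReal.le_div_iff_mul_le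
      (Or.inl (by simp [hE, hs, hs.le])) (Or.inl (by simp [hE0, hs.le])), ENNReal.div_eq_inv_mul,
    ENNReal.inv_rpow, inv_inv] at h
  have hpow : E ^ s = ENNReal.ofReal (exp (s * γ)) ^ T := by
    rw [hE, ENNReal.ofReal_rpow_of_pos (exp_pos _), ← ENNReal.ofReal_pow (exp_pos _).le,
      ← Real.exp_mul, ← Real.exp_nat_mul]
    congr 2
    ring
  rw [mul_pow, ← hpow]
  refine (measure_mono_ae ?_).trans h
  -- Zero ratios are excluded so that inversion commutes with the product, which may also contain
  -- infinite factors.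
  have h0 : ∀ᵐ z ∂(Measure.pi fun _ : Fin T => P), ∀ τ, likelihoodRatio P (z τ) ≠ 0 :=
    eventually_all.2 fun τ => (Measure.tendsto_eval_ae_ae (μ := fun _ : Fin T => P)
      (i := τ)).eventually
      (p := fun a => likelihoodRatio P a ≠ 0)
      ((inv_likelihoodRatio_ae_eq P).mono fun z hz => hz.1)
  filter_upwards [h0] with z hz hzt
  have hle : ∏ τ, likelihoodRatio P (z τ) ≤ E := not_lt.1 hzt
  change (E ^ s)⁻¹ ≤ ∏ τ, ((likelihoodRatio P (z τ))⁻¹) ^ s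
  rw [← ENNReal.inv_rpow, ENNReal.prod_rpow_of_nonneg hs.le]
  refine ENNReal.rpow_le_rpow ?_ hs.le
  rw [← ENNReal.prod_inv_distrib fun i _ j _ _ => Or.inl (hz i)]
  exact ENNReal.inv_le_inv.2 hle

end LikelihoodRatio

/-! ## Random codebooks -/

/-- A wrong codeword of user `i` is independent of all sent codewords, hence of the output they
cause: it occupies another slot of the codebook. -/
lemma map_pi_pi_pair {ι : Type*} [Fintype ι] [DecidableEq ι] {W : ι → Type*}
    [∀ j, MeasurableSpace (W j)]
    (ν : ∀ j, Measure (W j)) [∀ j, IsProbabilityMeasure (ν j)] {M : ι → ℕ} (w : ∀ j, Fin (M j))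
    (i : ι) {w' : Fin (M i)} (hw' : w' ≠ w i) :
    (Measure.pi fun j => Measure.pi fun _ : Fin (M j) => ν j).map
      (fun cb => (cb i w', fun j => cb j (w j))) = (ν i).prod (Measure.pi ν) := by
  have hm : Measurable fun cb : ∀ j, Fin (M j) → W j => (cb i w', fun j => cb j (w j)) := by
    fun_prop
  symm
  refine Measure.prod_eq_generateFrom (C := {s | MeasurableSet s})
    (D := Set.pi Set.univ '' Set.pi Set.univ fun j => {s : Set (W j) | MeasurableSet s})
    MeasurableSpace.generateFrom_measurableSet generateFrom_pi
    MeasurableSpace.isPiSystem_measurableSet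
    isPiSystem_pi (Measure.toFiniteSpanningSetsIn _)
    ⟨fun _ => Set.univ, fun _ => ⟨fun _ => Set.univ, by simp, by simp⟩,
      fun _ => measure_lt_top _ _, Set.iUnion_const _⟩ ?_
  rintro s hs _ ⟨t, ht, rfl⟩
  have ht' (j) : MeasurableSet (t j) := ht j trivial
  have hs' : MeasurableSet s := hs
  rw [Measure.map_apply hm (hs'.prod (MeasurableSet.univ_pi ht'))]
  set G : ∀ j, Set (Fin (M j) → W j) := fun j => {c | c (w j) ∈ t j} with hG
  have hpre : (fun cb : ∀ j, Fin (M j) → W j => (cb i w', fun j => cb j (w j))) ⁻¹'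
      (s ×ˢ Set.univ.pi t) = Set.univ.pi (Function.update G i (G i ∩ {c | c w' ∈ s})) := by
    ext cb
    simp only [Set.mem_preimage, Set.mem_prod, Set.mem_pi, Set.mem_univ, true_implies]
    constructor
    · rintro ⟨h1, h2⟩ j
      rcases eq_or_ne j i with rfl | hj
      · rw [Function.update_self]; exact ⟨h2 j, h1⟩
      · rw [Function.update_of_ne hj]; exact h2 j
    · intro h
      have hi := h i
      rw [Function.update_self] at hi
      refine ⟨hi.2, fun j => ?_⟩
      rcases eq_or_ne j i with rfl | hj
      · exact hi.1
      · have := h j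
        rw [Function.update_of_ne hj] at this
        exact this
  have hGj (j) : (Measure.pi fun _ : Fin (M j) => ν j) (G j) = ν j (t j) := by
    have := (measurePreserving_eval (fun _ : Fin (M j) => ν j) (w j)).measure_preimage
      (ht' j).nullMeasurableSet
    exact this
  have hGi : (Measure.pi fun _ : Fin (M i) => ν i) (G i ∩ {c | c w' ∈ s}) = ν i s * ν i (t i) := by
    have : G i ∩ {c | c w' ∈ s} = Set.univ.pi fun v =>
        if v = w i then t i else if v = w' then s else Set.univ := by
      ext c
      simp only [hG, Set.mem_inter_iff, Set.mem_ofPred_eq, Set.mem_pi, Set.mem_univ, true_implies]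
      constructor
      · rintro ⟨h1, h2⟩ v
        split_ifs with h3 h4
        · exact h3 ▸ h1
        · exact h4 ▸ h2
        · trivial
      · intro h
        have h1 := h (w i)
        have h2 := h w'
        rw [if_pos rfl] at h1
        rw [if_neg hw', if_pos rfl] at h2
        exact ⟨h1, h2⟩
    rw [this, Measure.pi_pi]
    have h3 (v : Fin (M i)) : ν i (if v = w i then t i else if v = w' then s else Set.univ) =
        (if v = w i then ν i (t i) else 1) * (if v = w' then ν i s else 1) := by
      by_cases h1 : v = w i
      · have h2 : v ≠ w' := fun h => hw' (h.symm.trans h1)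
        simp [h1, hw'.symm]
      · by_cases h2 : v = w'
        · simp [h2, hw']
        · simp [h1, h2]
    simp_rw [h3, Finset.prod_mul_distrib, Finset.prod_ite_eq', Finset.mem_univ, if_true]
    exact mul_comm _ _
  rw [hpre, Measure.pi_pi, Measure.pi_pi, ← Finset.mul_prod_erase _ _ (Finset.mem_univ i),
    ← Finset.mul_prod_erase _ _ (Finset.mem_univ i), Function.update_self, hGi, mul_assoc]
  congr 2
  refine Finset.prod_congr rfl fun j hj => ?_
  rw [Function.update_of_ne (Finset.ne_of_mem_erase hj), hGj]

/-! ### Characterisation and measurability of the typicality decoder -/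

section Decoder

variable {A B : Type*} [MeasurableSpace A] [MeasurableSpace B] (P : Measure (A × B)) (γ : ℝ)
  {T M : ℕ} [NeZero M]

lemma typicalityDecoder_eq_of_unique {cb : Fin M → Fin T → A} {y : Fin T → B} {w : Fin M}
    (h : IsTypical P γ (cb w) y) (h' : ∀ w', w' ≠ w → ¬ IsTypical P γ (cb w') y) :
    typicalityDecoder P γ cb y = w := by
  have hex : ∃! w, IsTypical P γ (cb w) y :=
    ⟨w, h, fun v hv => by by_contra hne; exact h' v hne hv⟩
  rw [typicalityDecoder, dif_pos hex]
  exact hex.unique hex.choose_spec.1 h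

/-- This removes the choice from the decoder: only typicality events and quantifiers over the finite
message set remain, so measurability can be read off. -/
lemma typicalityDecoder_eq_iff {cb : Fin M → Fin T → A} {y : Fin T → B} {w : Fin M} :
    typicalityDecoder P γ cb y = w ↔
      (IsTypical P γ (cb w) y ∧ ∀ v, IsTypical P γ (cb v) y → v = w) ∨
      (w = 0 ∧ ¬ ∃ u, IsTypical P γ (cb u) y ∧ ∀ v, IsTypical P γ (cb v) y → v = u) := by
  constructor
  · rintro rfl
    by_cases h : ∃! w, IsTypical P γ (cb w) y
    · left
      rw [typicalityDecoder, dif_pos h]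
      exact h.choose_spec
    · right
      exact ⟨by rw [typicalityDecoder, dif_neg h], h⟩
  · rintro (⟨h1, h2⟩ | ⟨rfl, h⟩)
    · exact typicalityDecoder_eq_of_unique P γ h1 fun v hv hv' => hv (h2 v hv')
    · have h' : ¬ ∃! w, IsTypical P γ (cb w) y := h
      rw [typicalityDecoder, dif_neg h']

lemma measurableSet_typicalityDecoder_eq (w : Fin M) :
    MeasurableSet {z : (Fin M → Fin T → A) × (Fin T → B) |
      typicalityDecoder P γ z.1 z.2 = w} := by
  have h (v : Fin M) : Measurable fun z : (Fin M → Fin T → A) × (Fin T → B) =>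
      IsTypical P γ (z.1 v) z.2 :=
    measurableSet_setOfPred.1 ((measurableSet_isTypical P γ T).preimage
      (f := fun z : (Fin M → Fin T → A) × (Fin T → B) => (z.1 v, z.2)) (by fun_prop))
  simp_rw [typicalityDecoder_eq_iff]
  refine measurableSet_setOfPred.2 ?_
  exact ((h w).and (Measurable.forall fun v => (h v).imp measurable_const)).or
    (measurable_const.and (Measurable.exists fun u =>
      (h u).and (Measurable.forall fun v => (h v).imp measurable_const)).not)

lemma measurable_typicalityDecoder (cb : Fin M → Fin T → A) :
    Measurable (typicalityDecoder P γ cb : (Fin T → B) → Fin M) :=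
  measurable_to_countable' fun w =>
    (measurableSet_typicalityDecoder_eq P γ w).preimage (measurable_prodMk_left (x := cb))

end Decoder

namespace ManyToOneChannel

variable {n : ℕ} {X Y : Fin (n + 1) → Type*} {V : Type*}
  [∀ i, MeasurableSpace (X i)] [∀ i, MeasurableSpace (Y i)] [MeasurableSpace V]
  (C : ManyToOneChannel n X Y V) (p : ∀ i, ProbabilityMeasure (X i))

/-- The transition law from all inputs to the output of user `i`. -/
def outputKernel (i : Fin (n + 1)) : Kernel (∀ j, X j) (Y i) := C.channel.map (Function.eval i)

instance (i : Fin (n + 1)) : IsMarkovKernel (C.outputKernel i) :=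
  Kernel.IsMarkovKernel.map _ (measurable_pi_apply i)

lemma outputKernel_apply (i : Fin (n + 1)) (x : ∀ j, X j) :
    C.outputKernel i x = (C.channel x).map (Function.eval i) :=
  Kernel.map_apply _ (measurable_pi_apply i) _

lemma userLaw_eq_map (i : Fin (n + 1)) :
    C.userLaw p i = ((Measure.pi fun j => (p j : Measure (X j))) ⊗ₘ C.outputKernel i).map
      fun z => (z.1 i, z.2) := by
  rw [userLaw, outputKernel, Measure.compProd_map (measurable_pi_apply i),
    Measure.map_map (by fun_prop) (by fun_prop)]
  rfl

instance (i : Fin (n + 1)) : IsProbabilityMeasure (C.userLaw p i) := by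
  rw [userLaw_eq_map]
  exact Measure.isProbabilityMeasure_map (by fun_prop)

lemma userLaw_fst (i : Fin (n + 1)) : (C.userLaw p i).fst = p i := by
  rw [userLaw_eq_map, Measure.fst, Measure.map_map measurable_fst (by fun_prop)]
  have : (Prod.fst ∘ fun z : (∀ j, X j) × Y i => (z.1 i, z.2)) = Function.eval i ∘ Prod.fst := rfl
  rw [this, ← Measure.map_map (measurable_pi_apply i) measurable_fst, ← Measure.fst,
    Measure.fst_compProd, (measurePreserving_eval _ i).map_eq]

lemma userLaw_snd (i : Fin (n + 1)) : (C.userLaw p i).snd =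
    C.outputKernel i ∘ₘ (Measure.pi fun j => (p j : Measure (X j))) := by
  rw [userLaw_eq_map, Measure.snd, Measure.map_map measurable_snd (by fun_prop)]
  exact Measure.snd_compProd _ _

/-! ### Average error probability over the codebooks -/

section Block

variable {T : ℕ}

lemma channel_block_map (i : Fin (n + 1)) (x : Fin T → ∀ j, X j) :
    (Measure.pi fun τ => C.channel (x τ)).map (fun y τ => y τ i) =
      piKernel (fun _ : Fin T => C.outputKernel i) x := by
  have hp (τ : Fin T) : IsProbabilityMeasure ((C.channel (x τ)).map (Function.eval i)) :=
    Measure.isProbabilityMeasure_map (measurable_pi_apply i).aemeasurable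
  rw [piKernel_apply]
  simp_rw [outputKernel_apply]
  rw [← Measure.pi_map_pi fun τ => (measurable_pi_apply i).aemeasurable]

/-- The inputs are independent over time and the channel is memoryless, so the input-output pairs of
user `i` are i.i.d. with the single-letter law. -/
lemma lintegral_block_not_isTypical (γ : ℝ) (i : Fin (n + 1)) :
    ∫⁻ x, piKernel (fun _ : Fin T => C.outputKernel i) x
        {y | ¬ IsTypical (C.userLaw p i) γ (fun τ => x τ i) y}
      ∂(Measure.pi fun _ : Fin T => Measure.pi fun j => (p j : Measure (X j))) =
    (Measure.pi fun _ : Fin T => C.userLaw p i)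
      {z | ¬ IsTypical (C.userLaw p i) γ (fun τ => (z τ).1) (fun τ => (z τ).2)} := by
  have hT := measurableSet_isTypical (C.userLaw p i) γ T
  have hS : MeasurableSet {z : (Fin T → ∀ j, X j) × (Fin T → Y i) |
      ¬ IsTypical (C.userLaw p i) γ (fun τ => z.1 τ i) z.2} :=
    (hT.preimage (f := fun z : (Fin T → ∀ j, X j) × (Fin T → Y i) => (fun τ => z.1 τ i, z.2))
      (by fun_prop)).compl
  have hS' : MeasurableSet {z : Fin T → (∀ j, X j) × Y i |
      ¬ IsTypical (C.userLaw p i) γ (fun τ => (z τ).1 i) (fun τ => (z τ).2)} :=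
    (hT.preimage (f := fun z : Fin T → (∀ j, X j) × Y i =>
      (fun τ => (z τ).1 i, fun τ => (z τ).2)) (by fun_prop)).compl
  have hS'' : MeasurableSet {z : Fin T → X i × Y i |
      ¬ IsTypical (C.userLaw p i) γ (fun τ => (z τ).1) (fun τ => (z τ).2)} :=
    (hT.preimage (f := fun z : Fin T → X i × Y i =>
      (fun τ => (z τ).1, fun τ => (z τ).2)) (by fun_prop)).compl
  calc _ = ((Measure.pi fun _ : Fin T => Measure.pi fun j => (p j : Measure (X j))) ⊗ₘ
        piKernel fun _ : Fin T => C.outputKernel i) {z : (Fin T → ∀ j, X j) × (Fin T → Y i) |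
          ¬ IsTypical (C.userLaw p i) γ (fun τ => z.1 τ i) z.2} :=
        (Measure.compProd_apply hS).symm
    _ = (Measure.pi fun _ : Fin T => (Measure.pi fun j => (p j : Measure (X j))) ⊗ₘ
          C.outputKernel i) {z | ¬ IsTypical (C.userLaw p i) γ (fun τ => (z τ).1 i)
            (fun τ => (z τ).2)} := by
        rw [← map_pi_compProd_piKernel (fun _ : Fin T => C.outputKernel i), Measure.map_apply
          (by fun_prop) hS']
        rfl
    _ = _ := by
        have hp (τ : Fin T) : IsProbabilityMeasure (((Measure.pi fun j => (p j : Measure (X j))) ⊗ₘ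
            C.outputKernel i).map fun z => (z.1 i, z.2)) :=
          Measure.isProbabilityMeasure_map (by fun_prop)
        conv_rhs => rw [userLaw_eq_map C p i]
        rw [← Measure.pi_map_pi (ι := Fin T) fun τ => by fun_prop, Measure.map_apply (by fun_prop)]
        · rw [← userLaw_eq_map C p i]; rfl
        · rw [← userLaw_eq_map C p i]; exact hS''

/-- The codeword `a` is independent of the inputs `x` that cause the output; hence the pairs are
i.i.d. with the product of the marginals as law. -/
lemma lintegral_block_isTypical (γ : ℝ) (i : Fin (n + 1)) :
    ∫⁻ a, ∫⁻ x, piKernel (fun _ : Fin T => C.outputKernel i) x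
        {y | IsTypical (C.userLaw p i) γ a y}
      ∂(Measure.pi fun _ : Fin T => Measure.pi fun j => (p j : Measure (X j)))
      ∂(Measure.pi fun _ : Fin T => (p i : Measure (X i))) =
    (Measure.pi fun _ : Fin T => (C.userLaw p i).fst.prod (C.userLaw p i).snd)
      {z | IsTypical (C.userLaw p i) γ (fun τ => (z τ).1) (fun τ => (z τ).2)} := by
  have hT := measurableSet_isTypical (C.userLaw p i) γ T
  have hTa (a : Fin T → X i) : MeasurableSet {y | IsTypical (C.userLaw p i) γ a y} :=
    hT.preimage measurable_prodMk_left
  have hS'' : MeasurableSet {z : Fin T → X i × Y i |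
      IsTypical (C.userLaw p i) γ (fun τ => (z τ).1) (fun τ => (z τ).2)} :=
    hT.preimage (f := fun z : Fin T → X i × Y i =>
      (fun τ => (z τ).1, fun τ => (z τ).2)) (by fun_prop)
  have h1 (a : Fin T → X i) : ∫⁻ x, piKernel (fun _ : Fin T => C.outputKernel i) x
      {y | IsTypical (C.userLaw p i) γ a y}
      ∂(Measure.pi fun _ : Fin T => Measure.pi fun j => (p j : Measure (X j))) =
      piKernel (fun _ : Fin T => Kernel.const (X i) (C.userLaw p i).snd) a
        {y | IsTypical (C.userLaw p i) γ a y} := by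
    refine (Measure.bind_apply (hTa a) (Kernel.aemeasurable _)).symm.trans ?_
    rw [piKernel_comp_pi, piKernel_apply]
    simp_rw [Kernel.const_apply, userLaw_snd]
  simp_rw [h1, userLaw_fst]
  refine (Measure.compProd_apply hT).symm.trans ?_
  simp_rw [← Measure.compProd_const]
  rw [← map_pi_compProd_piKernel (fun _ : Fin T => Kernel.const (X i) (C.userLaw p i).snd),
    Measure.map_apply (by fun_prop) hS'']
  rfl

variable {M : Fin (n + 1) → ℕ}

instance : IsProbabilityMeasure (codebookLaw p T M) := by unfold codebookLaw; infer_instance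

lemma codebookLaw_map (w : ∀ j, Fin (M j)) :
    (codebookLaw p T M).map (fun cb τ j => cb j (w j) τ) =
      Measure.pi fun _ : Fin T => Measure.pi fun j => (p j : Measure (X j)) := by
  have h : (codebookLaw p T M).map (fun cb j => cb j (w j)) =
      Measure.pi fun j => Measure.pi fun _ : Fin T => (p j : Measure (X j)) :=
    (measurePreserving_pi _ _ fun j => measurePreserving_eval
      (fun _ : Fin (M j) => Measure.pi fun _ : Fin T => (p j : Measure (X j))) (w j)).map_eq
  rw [← map_pi_pi_swap fun j (_ : Fin T) => (p j : Measure (X j)), ← h,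
    Measure.map_map (by fun_prop) (by fun_prop)]
  rfl

lemma codebookLaw_map_pair (w : ∀ j, Fin (M j)) (i : Fin (n + 1)) {w' : Fin (M i)}
    (hw' : w' ≠ w i) :
    (codebookLaw p T M).map (fun cb => (cb i w', fun τ j => cb j (w j) τ)) =
      (Measure.pi fun _ : Fin T => (p i : Measure (X i))).prod
        (Measure.pi fun _ : Fin T => Measure.pi fun j => (p j : Measure (X j))) := by
  have h := map_pi_pi_pair (fun j => Measure.pi fun _ : Fin T => (p j : Measure (X j))) w i hw'
  rw [← map_pi_pi_swap fun j (_ : Fin T) => (p j : Measure (X j))]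
  have h2 := (Measure.map_prod_map (Measure.pi fun _ : Fin T => (p i : Measure (X i)))
    (Measure.pi fun j => Measure.pi fun _ : Fin T => (p j : Measure (X j))) measurable_id
    (g := fun (x : ∀ j, Fin T → X j) t j => x j t) (by fun_prop))
  rw [Measure.map_id] at h2
  rw [h2, ← h, Measure.map_map (by fun_prop) (by fun_prop)]
  rfl

/-- The block channel from the codebooks to the outputs when the messages `w` are sent. -/
def codebookKernel (w : ∀ j, Fin (M j)) :
    Kernel (∀ j, Fin (M j) → Fin T → X j) (Fin T → ∀ j, Y j) :=
  (piKernel fun _ : Fin T => C.channel).comap (fun cb τ j => cb j (w j) τ) (by fun_prop)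

instance (w : ∀ j, Fin (M j)) : IsMarkovKernel (C.codebookKernel (T := T) w) := by
  unfold codebookKernel; infer_instance

lemma codebookKernel_map (w : ∀ j, Fin (M j)) (cb : ∀ j, Fin (M j) → Fin T → X j)
    (i : Fin (n + 1)) {S : Set (Fin T → Y i)} (hS : MeasurableSet S) :
    C.codebookKernel w cb {y | (fun τ => y τ i) ∈ S} =
      piKernel (fun _ : Fin T => C.outputKernel i) (fun τ j => cb j (w j) τ) S := by
  rw [← channel_block_map, Measure.map_apply (by fun_prop) hS]
  rfl

variable [∀ i, NeZero (M i)]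

lemma measurableSet_userError (γ : ℝ) (w : ∀ j, Fin (M j)) (i : Fin (n + 1)) :
    MeasurableSet {z : (∀ j, Fin (M j) → Fin T → X j) × (Fin T → ∀ j, Y j) |
      typicalityDecoder (C.userLaw p i) γ (z.1 i) (fun τ => z.2 τ i) ≠ w i} :=
  ((measurableSet_typicalityDecoder_eq (C.userLaw p i) γ (w i)).preimage
    (f := fun z : (∀ j, Fin (M j) → Fin T → X j) × (Fin T → ∀ j, Y j) =>
      (z.1 i, fun τ => z.2 τ i)) (by fun_prop)).compl

/-- Union bound: a decoding error requires that the sent codeword is not typical or that one of the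
`M i - 1` others is. Averaging over the codebooks of all users is what turns the interference into
memoryless noise. -/
lemma lintegral_userError_le (γ : ℝ) (w : ∀ j, Fin (M j)) (i : Fin (n + 1)) :
    ∫⁻ cb, C.codebookKernel w cb
        {y | typicalityDecoder (C.userLaw p i) γ (cb i) (fun τ => y τ i) ≠ w i}
      ∂(codebookLaw p T M) ≤
    (Measure.pi fun _ : Fin T => C.userLaw p i)
      {z | ¬ IsTypical (C.userLaw p i) γ (fun τ => (z τ).1) (fun τ => (z τ).2)} +
    (M i - 1 : ℕ) * (Measure.pi fun _ : Fin T => (C.userLaw p i).fst.prod (C.userLaw p i).snd)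
      {z | IsTypical (C.userLaw p i) γ (fun τ => (z τ).1) (fun τ => (z τ).2)} := by
  have hT := measurableSet_isTypical (C.userLaw p i) γ T
  have hTa (a : Fin T → X i) : MeasurableSet {y | IsTypical (C.userLaw p i) γ a y} :=
    hT.preimage measurable_prodMk_left
  set F : (Fin T → ∀ j, X j) → ℝ≥0∞ := fun x => piKernel (fun _ : Fin T => C.outputKernel i) x
    {y | ¬ IsTypical (C.userLaw p i) γ (fun τ => x τ i) y} with hF
  have hFm : Measurable F := Kernel.measurable_kernel_prodMk_left
    (κ := piKernel fun _ : Fin T => C.outputKernel i)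
    (t := {z | ¬ IsTypical (C.userLaw p i) γ (fun τ => z.1 τ i) z.2})
    (hT.preimage (f := fun z : (Fin T → ∀ j, X j) × (Fin T → Y i) => (fun τ => z.1 τ i, z.2))
      (by fun_prop)).compl
  set G : (Fin T → X i) × (Fin T → ∀ j, X j) → ℝ≥0∞ := fun z =>
    piKernel (fun _ : Fin T => C.outputKernel i) z.2
      {y | IsTypical (C.userLaw p i) γ z.1 y} with hG
  have hGm : Measurable G := Kernel.measurable_kernel_prodMk_left
    (κ := (piKernel fun _ : Fin T => C.outputKernel i).comap
      (Prod.snd : (Fin T → X i) × _ → _) measurable_snd)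
    (t := {z | IsTypical (C.userLaw p i) γ z.1.1 z.2})
    (hT.preimage (f := fun z : ((Fin T → X i) × (Fin T → ∀ j, X j)) × (Fin T → Y i) =>
      (z.1.1, z.2)) (by fun_prop))
  have hpt (cb : ∀ j, Fin (M j) → Fin T → X j) : C.codebookKernel w cb
      {y | typicalityDecoder (C.userLaw p i) γ (cb i) (fun τ => y τ i) ≠ w i} ≤
      F (fun τ j => cb j (w j) τ) +
        ∑ w' ∈ Finset.univ.erase (w i), G (cb i w', fun τ j => cb j (w j) τ) := by
    have e1 : F (fun τ j => cb j (w j) τ) = C.codebookKernel w cb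
        {y | ¬ IsTypical (C.userLaw p i) γ (cb i (w i)) (fun τ => y τ i)} :=
      (codebookKernel_map C w cb i (hTa (cb i (w i))).compl).symm
    have e2 (w') : G (cb i w', fun τ j => cb j (w j) τ) = C.codebookKernel w cb
        {y | IsTypical (C.userLaw p i) γ (cb i w') (fun τ => y τ i)} :=
      (codebookKernel_map C w cb i (hTa (cb i w'))).symm
    simp_rw [e1, e2]
    refine le_trans (measure_mono ?_) ((measure_union_le _ _).trans
      (add_le_add_right (measure_biUnion_finset_le (Finset.univ.erase (w i)) _) _))
    intro y hy
    by_contra hcon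
    rw [Set.mem_union, not_or] at hcon
    refine hy (typicalityDecoder_eq_of_unique _ _ ?_ fun v hv => ?_)
    · exact not_not.1 hcon.1
    · intro htyp
      refine hcon.2 (Set.mem_biUnion (x := v) ?_ htyp)
      simpa using hv
  refine (lintegral_mono hpt).trans ?_
  have hFc : Measurable fun cb : ∀ j, Fin (M j) → Fin T → X j => F (fun τ j => cb j (w j) τ) :=
    hFm.comp (by fun_prop)
  have hGc (w') : Measurable fun cb : ∀ j, Fin (M j) → Fin T → X j =>
      G (cb i w', fun τ j => cb j (w j) τ) := hGm.comp (by fun_prop)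
  have e3 : ∫⁻ cb, F (fun τ j => cb j (w j) τ) ∂(codebookLaw p T M) = ∫⁻ x, F x
      ∂(Measure.pi fun _ : Fin T => Measure.pi fun j => (p j : Measure (X j))) := by
    rw [← codebookLaw_map p w, lintegral_map hFm (by fun_prop)]
  rw [lintegral_add_left hFc, lintegral_finsetSum _ fun w' _ => hGc w', e3,
    lintegral_block_not_isTypical]
  refine add_le_add_right (le_of_eq ?_) _
  have hw' (w' : Fin (M i)) (h : w' ∈ Finset.univ.erase (w i)) :
      ∫⁻ cb, G (cb i w', fun τ j => cb j (w j) τ) ∂(codebookLaw p T M) =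
      (Measure.pi fun _ : Fin T => (C.userLaw p i).fst.prod (C.userLaw p i).snd)
        {z | IsTypical (C.userLaw p i) γ (fun τ => (z τ).1) (fun τ => (z τ).2)} := by
    rw [← lintegral_map (g := fun cb : ∀ j, Fin (M j) → Fin T → X j =>
      (cb i w', fun τ j => cb j (w j) τ)) hGm (by fun_prop),
      codebookLaw_map_pair p w i (Finset.ne_of_mem_erase h), lintegral_prod _ hGm.aemeasurable,
      ← lintegral_block_isTypical]
  rw [Finset.sum_congr rfl hw', Finset.sum_const, Finset.card_erase_of_mem (Finset.mem_univ _),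
    Finset.card_univ, Fintype.card_fin, nsmul_eq_mul]

lemma errorProb_typicalityDecoder_eq (γ : Fin (n + 1) → ℝ)
    (cb : ∀ j, Fin (M j) → Fin T → X j) :
    C.errorProb cb (fun i => typicalityDecoder (C.userLaw p i) (γ i) (cb i)) =
      (∏ i, (M i : ℝ≥0∞))⁻¹ * ∑ w : ∀ i, Fin (M i), C.codebookKernel w cb
        {y | ∃ i, typicalityDecoder (C.userLaw p i) (γ i) (cb i) (fun τ => y τ i) ≠ w i} := rfl

lemma measurable_errorProb_typicalityDecoder (γ : Fin (n + 1) → ℝ) :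
    Measurable fun cb : ∀ j, Fin (M j) → Fin T → X j =>
      C.errorProb cb (fun i => typicalityDecoder (C.userLaw p i) (γ i) (cb i)) := by
  simp_rw [errorProb_typicalityDecoder_eq]
  refine (Finset.measurable_sum _ fun w _ => ?_).const_mul _
  refine Kernel.measurable_kernel_prodMk_left (κ := C.codebookKernel w)
    (t := {z | ∃ i, typicalityDecoder (C.userLaw p i) (γ i) (z.1 i) (fun τ => z.2 τ i) ≠ w i}) ?_
  rw [Set.ofPred_exists]
  exact MeasurableSet.iUnion fun i => C.measurableSet_userError p (γ i) w i

lemma lintegral_errorProb_le (γ : Fin (n + 1) → ℝ) (a : Fin (n + 1) → ℝ≥0∞)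
    (ha : ∀ i (w : ∀ j, Fin (M j)), ∫⁻ cb, C.codebookKernel w cb
        {y | typicalityDecoder (C.userLaw p i) (γ i) (cb i) (fun τ => y τ i) ≠ w i}
      ∂(codebookLaw p T M) ≤ a i) :
    ∫⁻ cb, C.errorProb cb (fun i => typicalityDecoder (C.userLaw p i) (γ i) (cb i))
      ∂(codebookLaw p T M) ≤ ∑ i, a i := by
  have hm (i) (w : ∀ j, Fin (M j)) : Measurable fun cb : ∀ j, Fin (M j) → Fin T → X j =>
      C.codebookKernel w cb
      {y | typicalityDecoder (C.userLaw p i) (γ i) (cb i) (fun τ => y τ i) ≠ w i} :=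
    Kernel.measurable_kernel_prodMk_left (κ := C.codebookKernel w)
      (C.measurableSet_userError p (γ i) w i)
  calc _ ≤ ∫⁻ cb, (∏ i, (M i : ℝ≥0∞))⁻¹ * ∑ w : ∀ i, Fin (M i), ∑ i, C.codebookKernel w cb
        {y | typicalityDecoder (C.userLaw p i) (γ i) (cb i) (fun τ => y τ i) ≠ w i}
        ∂(codebookLaw p T M) := by
        refine lintegral_mono fun cb => ?_
        rw [errorProb_typicalityDecoder_eq]
        gcongr with w
        rw [Set.ofPred_exists]
        exact measure_iUnion_fintype_le _ _
    _ = (∏ i, (M i : ℝ≥0∞))⁻¹ * ∑ w : ∀ i, Fin (M i), ∑ i, ∫⁻ cb, C.codebookKernel w cb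
        {y | typicalityDecoder (C.userLaw p i) (γ i) (cb i) (fun τ => y τ i) ≠ w i}
        ∂(codebookLaw p T M) := by
        rw [lintegral_const_mul _ (Finset.measurable_sum _ fun w _ =>
          Finset.measurable_sum _ fun i _ => hm i w), lintegral_finsetSum _ fun w _ =>
          Finset.measurable_sum _ fun i _ => hm i w]
        simp_rw [lintegral_finsetSum _ fun i _ => hm i _]
    _ ≤ (∏ i, (M i : ℝ≥0∞))⁻¹ * ∑ _w : ∀ i, Fin (M i), ∑ i, a i := by
        gcongr with w _ i _
        exact ha i w
    _ = ∑ i, a i := by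
        rw [Finset.sum_const, Finset.card_univ, Fintype.card_pi, nsmul_eq_mul, ← mul_assoc]
        simp only [Fintype.card_fin]
        rw [Nat.cast_prod, ENNReal.inv_mul_cancel, one_mul]
        · exact Finset.prod_ne_zero_iff.2 fun i _ => by simp [NeZero.ne]
        · exact ENNReal.prod_ne_top fun i _ => by simp

end Block

end ManyToOneChannel

/-! ## Achievability -/

open Real in
lemma exp_le_messageCount (R : ℝ) (T : ℕ) : exp (T * R) ≤ messageCount R T := Nat.le_ceil _

lemma messageCount_zero (T : ℕ) : messageCount 0 T = 1 := by simp [messageCount]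

open Real in
lemma messageCount_sub_one_le (R : ℝ) (T : ℕ) :
    ((messageCount R T - 1 : ℕ) : ℝ≥0∞) ≤ ENNReal.ofReal (exp (T * R)) := by
  have h1 : 1 ≤ messageCount R T := NeZero.one_le
  rw [← ENNReal.ofReal_natCast]
  refine ENNReal.ofReal_le_ofReal ?_
  rw [Nat.cast_sub h1, Nat.cast_one]
  have := Nat.ceil_lt_add_one (exp_pos (T * R)).le
  rw [messageCount]
  linarith

lemma le_log_messageCount_div (R : ℝ) {T : ℕ} (hT : 0 < T) :
    R ≤ Real.log (messageCount R T) / T := by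
  have hT' : (0 : ℝ) < T := Nat.cast_pos.2 hT
  rw [le_div_iff₀ hT', mul_comm, Real.le_log_iff_exp_le (Nat.cast_pos.2 (NeZero.pos _))]
  exact exp_le_messageCount R T

/-- For `R ≥ 0`, `⌈exp (T * R)⌉ ≤ exp (T * R) + 1 ≤ 2 * exp (T * R) ≤ exp (T * R + 1)`. -/
lemma log_messageCount_div_le {R : ℝ} (hR : 0 ≤ R) {T : ℕ} (hT : 0 < T) :
    Real.log (messageCount R T) / T ≤ R + 1 / T := by
  have hT' : (0 : ℝ) < T := Nat.cast_pos.2 hT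
  rw [div_le_iff₀ hT', Real.log_le_iff_le_exp (Nat.cast_pos.2 (NeZero.pos _))]
  have h1 : (R + 1 / T) * T = T * R + 1 := by field_simp
  have h2 : (1 : ℝ) ≤ Real.exp (T * R) := Real.one_le_exp (by positivity)
  have h3 := Nat.ceil_lt_add_one (Real.exp_pos (T * R)).le
  have h4 : (2 : ℝ) ≤ Real.exp 1 := by linarith [Real.add_one_le_exp (1 : ℝ)]
  rw [h1, Real.exp_add, messageCount]
  nlinarith

lemma tendsto_log_messageCount_div {R : ℝ} (hR : 0 ≤ R) :
    Tendsto (fun T : ℕ => Real.log (messageCount R T) / T) atTop (𝓝 R) := by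
  have h : Tendsto (fun T : ℕ => R + 1 / (T : ℝ)) atTop (𝓝 R) := by
    simpa using tendsto_const_nhds.add (tendsto_one_div_atTop_nhds_zero_nat (𝕜 := ℝ))
  refine tendsto_of_tendsto_of_tendsto_of_le_of_le' tendsto_const_nhds h ?_ ?_
  · filter_upwards [eventually_gt_atTop 0] with T hT using le_log_messageCount_div R hT
  · filter_upwards [eventually_gt_atTop 0] with T hT using log_messageCount_div_le hR hT

/-- At these rates and lengths the ceiling rounds nothing, so random coding yields codes of exactly
the prescribed rate, as `Achievable` requires. -/
lemma messageCount_log_div {m t : ℕ} (hm : 0 < m) (ht : 0 < t) (k : ℕ) :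
    messageCount (Real.log m / t) (k * t) = m ^ k := by
  have h1 : ((k * t : ℕ) : ℝ) * (Real.log m / t) = k * Real.log m := by
    have : (t : ℝ) ≠ 0 := Nat.cast_ne_zero.2 ht.ne'
    push_cast
    field_simp
  rw [messageCount, h1, Real.exp_nat_mul, Real.exp_log (Nat.cast_pos.2 hm), ← Nat.cast_pow,
    Nat.ceil_natCast]

lemma exists_seq_lt_tendsto (I : ℝ≥0∞) : ∃ r : ℕ → ℝ,
    (∀ k, 0 ≤ r k ∧ (r k = 0 ∨ ENNReal.ofReal (r k) < I)) ∧
      Tendsto (fun k => ENNReal.ofReal (r k)) atTop (𝓝 I) := by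
  rcases eq_or_ne I 0 with rfl | hI
  · exact ⟨fun _ => 0, fun _ => ⟨le_rfl, Or.inl rfl⟩, by simp⟩
  obtain ⟨u, -, hu, hlim⟩ := exists_seq_strictMono_tendsto' (pos_iff_ne_zero.2 hI)
  have h (k) : ENNReal.ofReal (u k).toReal = u k := ENNReal.ofReal_toReal (hu k).2.ne_top
  refine ⟨fun k => (u k).toReal, fun k => ⟨ENNReal.toReal_nonneg, Or.inr ?_⟩, ?_⟩
  · rw [h]; exact (hu k).2
  · simpa only [h] using hlim

namespace ManyToOneChannel

variable {n : ℕ} {X Y : Fin (n + 1) → Type*} {V : Type*}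
  [∀ i, MeasurableSpace (X i)] [∀ i, MeasurableSpace (Y i)] [MeasurableSpace V]
  (C : ManyToOneChannel n X Y V) {p : ∀ i, ProbabilityMeasure (X i)} {R : Fin (n + 1) → ℝ}

open Real in
lemma exists_threshold {i : Fin (n + 1)}
    (hR : R i = 0 ∨ 0 ≤ R i ∧ ENNReal.ofReal (R i) < C.userInfo p i) :
    ∃ (γ : ℝ) (a : ℕ → ℝ≥0∞), Tendsto a atTop (𝓝 0) ∧
      ∀ (T : ℕ) (w : ∀ j, Fin (messageCount (R j) T)), ∫⁻ cb, C.codebookKernel w cb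
        {y | typicalityDecoder (C.userLaw p i) γ (cb i) (fun τ => y τ i) ≠ w i}
        ∂(codebookLaw p T fun j => messageCount (R j) T) ≤ a T := by
  rcases hR with hR | ⟨hR0, hR⟩
  -- At rate `0` there is a single message and no error, even when the information vanishes and
  -- leaves no room for a threshold.
  · refine ⟨0, fun _ => 0, tendsto_const_nhds, fun T w => ?_⟩
    have h1 : messageCount (R i) T = 1 := by rw [hR, messageCount_zero]
    have : Subsingleton (Fin (messageCount (R i) T)) := by rw [h1]; infer_instance
    simp only [ne_eq, Subsingleton.elim _ (w i), not_true_eq_false]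
    simp
  · obtain ⟨γ, -, hγR, hγI⟩ := ENNReal.lt_iff_exists_real_btwn.1 hR
    have hγ : R i < γ := (ENNReal.ofReal_lt_ofReal_iff_of_nonneg hR0).1 hγR
    obtain ⟨s, hs, hsI⟩ := exists_lintegral_inv_likelihoodRatio_rpow_lt (C.userLaw p i) hγI
    set c := ENNReal.ofReal (exp (s * γ)) *
      ∫⁻ z, ((likelihoodRatio (C.userLaw p i) z)⁻¹) ^ s ∂(C.userLaw p i) with hc
    have hc1 : c < 1 := by
      have h0 : ENNReal.ofReal (exp (s * γ)) ≠ 0 := by simp [exp_pos]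
      calc c < ENNReal.ofReal (exp (s * γ)) * ENNReal.ofReal (exp (-(s * γ))) :=
            (ENNReal.mul_lt_mul_iff_right h0 ENNReal.ofReal_ne_top).2 hsI
        _ = 1 := by
            rw [← ENNReal.ofReal_mul (exp_pos _).le, ← exp_add, add_neg_cancel, exp_zero,
              ENNReal.ofReal_one]
    set d := ENNReal.ofReal (exp (R i - γ)) with hd
    have hd1 : d < 1 := by
      rw [hd, ENNReal.ofReal_lt_one, exp_lt_one_iff]
      linarith
    refine ⟨γ, fun T => c ^ T + d ^ T, ?_, fun T w => ?_⟩
    · simpa using (ENNReal.tendsto_pow_atTop_nhds_zero_of_lt_one hc1).add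
        (ENNReal.tendsto_pow_atTop_nhds_zero_of_lt_one hd1)
    · refine (C.lintegral_userError_le p γ w i).trans (add_le_add
        (pi_not_isTypical_le (C.userLaw p i) γ T hs) ?_)
      refine (mul_le_mul' (messageCount_sub_one_le (R i) T)
        (pi_prod_isTypical_le (C.userLaw p i) γ T)).trans_eq ?_
      rw [hd, ← ENNReal.ofReal_mul (exp_pos _).le, ← exp_add, ← ENNReal.ofReal_pow (exp_pos _).le,
        ← exp_nat_mul]
      ring_nf

theorem randomCodingAchieves
    (hR : ∀ i, 0 ≤ R i ∧ (R i = 0 ∨ ENNReal.ofReal (R i) < C.userInfo p i)) :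
    C.RandomCodingAchieves p R := by
  have h (i) := C.exists_threshold (p := p) (R := R) (i := i)
    ((hR i).2.imp id fun h => ⟨(hR i).1, h⟩)
  choose γ a ha hle using h
  refine ⟨fun i => (hR i).1, γ, ?_⟩
  have hlim : Tendsto (fun T => ∑ i, a i T) atTop (𝓝 0) := by
    simpa using tendsto_finsetSum Finset.univ fun i _ => ha i
  exact tendsto_of_tendsto_of_tendsto_of_le_of_le tendsto_const_nhds hlim (fun _ => zero_le)
    fun T => C.lintegral_errorProb_le p γ (fun i => a i T) fun i w => hle i T w

variable {C}

/-- Some codebook is at least as good as the average. -/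
lemma RandomCodingAchieves.exists_codes (h : C.RandomCodingAchieves p R) :
    ∃ (enc : ∀ (T : ℕ) i, Fin (messageCount (R i) T) → Fin T → X i)
      (dec : ∀ (T : ℕ) i, (Fin T → Y i) → Fin (messageCount (R i) T)),
      (∀ T i, Measurable (dec T i)) ∧
      Tendsto (fun T => C.errorProb (enc T) (dec T)) atTop (𝓝 0) := by
  obtain ⟨-, γ, hγ⟩ := h
  have hex (T : ℕ) := exists_le_lintegral (μ := codebookLaw p T fun i => messageCount (R i) T)
    (C.measurable_errorProb_typicalityDecoder p γ).aemeasurable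
  choose enc henc using hex
  refine ⟨enc, fun T i => typicalityDecoder (C.userLaw p i) (γ i) (enc T i), fun T i => ?_,
    tendsto_of_tendsto_of_tendsto_of_le_of_le tendsto_const_nhds hγ (fun _ => zero_le) henc⟩
  exact measurable_typicalityDecoder _ _ _

/-- The actual rates are at least `R` because of the ceiling, so the converse is used in its form
with inequalities. Lengths start at `1` to be positive. -/
lemma RandomCodingAchieves.sum_rate_le (hC : C.IsDegraded) {S : ℝ≥0∞}
    (hI : ∀ p : ∀ i, ProbabilityMeasure (X i), ∑ i, C.userInfo p i ≤ S)
    (h : C.RandomCodingAchieves p R) : ENNReal.ofReal (∑ i, R i) ≤ S := by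
  obtain ⟨enc, dec, hdec, hlim⟩ := h.exists_codes
  exact C.sum_rate_le hC hI (T := fun k => k + 1) (fun k => enc (k + 1)) (fun k => dec (k + 1))
    (fun k => k.succ_pos) (fun k i => NeZero.pos _) (fun k => hdec (k + 1))
    (fun k i => le_log_messageCount_div _ k.succ_pos) (hlim.comp (tendsto_add_atTop_nat 1))

lemma RandomCodingAchieves.achievable {m : Fin (n + 1) → ℕ} (hm : ∀ i, 0 < m i) {t : ℕ}
    (ht : 0 < t) (h : C.RandomCodingAchieves p fun i => Real.log (m i) / t) :
    C.Achievable fun i => Real.log (m i) / t := by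
  obtain ⟨enc, dec, hdec, hlim⟩ := h.exists_codes
  refine ⟨fun k => (k + 1) * t, fun k i => messageCount (Real.log (m i) / t) ((k + 1) * t),
    fun k => enc ((k + 1) * t), fun k => dec ((k + 1) * t), fun k => by positivity,
    fun k i => NeZero.pos _, fun k => hdec _, fun k i => ?_, hlim.comp ?_⟩
  · beta_reduce
    rw [messageCount_log_div (hm i) ht]
    have : (t : ℝ) ≠ 0 := Nat.cast_ne_zero.2 ht.ne'
    have : ((k + 1 : ℕ) : ℝ) ≠ 0 := Nat.cast_ne_zero.2 k.succ_ne_zero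
    rw [Nat.cast_pow, Real.log_pow, Nat.cast_mul]
    field_simp
  · exact tendsto_atTop_mono (fun k => (Nat.le_succ k).trans (Nat.le_mul_of_pos_right _ ht))
      tendsto_id

variable (C)

/-- A general rate tuple need not be exactly the rate of any code. It is approximated by the actual
rates `log ⌈exp (T * R)⌉ / T`, which are eventually still below the informations and are achievable
along the multiples of `T`; the closure does the rest. -/
theorem mem_capacityRegion
    (hR : ∀ i, 0 ≤ R i ∧ (R i = 0 ∨ ENNReal.ofReal (R i) < C.userInfo p i)) :
    R ∈ C.capacityRegion := by
  refine mem_closure_of_tendsto (b := atTop)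
    (f := fun (T : ℕ) i => Real.log (messageCount (R i) T) / T)
    (tendsto_pi_nhds.2 fun i => tendsto_log_messageCount_div (hR i).1) ?_
  have h (i) : ∀ᶠ T : ℕ in atTop, Real.log (messageCount (R i) T) / T = 0 ∨
      ENNReal.ofReal (Real.log (messageCount (R i) T) / T) < C.userInfo p i := by
    rcases (hR i).2 with h | h
    · exact Eventually.of_forall fun T => Or.inl (by simp [h, messageCount_zero])
    · refine Eventually.mono ?_ fun T => Or.inr
      exact ((ENNReal.continuous_ofReal.tendsto _).comp
        (tendsto_log_messageCount_div (hR i).1)).eventually_lt_const h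
  filter_upwards [eventually_all.2 h, eventually_gt_atTop 0] with T hT hT0
  refine RandomCodingAchieves.achievable (p := p) (fun i => NeZero.pos _) hT0
    (C.randomCodingAchieves fun i => ⟨?_, hT i⟩)
  exact div_nonneg (Real.log_nonneg (Nat.one_le_cast.2 NeZero.one_le)) (Nat.cast_nonneg _)

theorem exists_seq_rates (p : ∀ i, ProbabilityMeasure (X i)) : ∃ R : ℕ → Fin (n + 1) → ℝ,
    (∀ k i, 0 ≤ R k i ∧ (R k i = 0 ∨ ENNReal.ofReal (R k i) < C.userInfo p i)) ∧
    ∀ i, Tendsto (fun k => ENNReal.ofReal (R k i)) atTop (𝓝 (C.userInfo p i)) := by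
  choose r hr hlim using fun i => exists_seq_lt_tendsto (C.userInfo p i)
  exact ⟨fun k i => r i k, fun k i => hr i k, hlim⟩

lemma sum_userInfo_le {S : ℝ≥0∞} (hS : ∀ R : Fin (n + 1) → ℝ,
    (∀ i, 0 ≤ R i ∧ (R i = 0 ∨ ENNReal.ofReal (R i) < C.userInfo p i)) →
      ENNReal.ofReal (∑ i, R i) ≤ S) : ∑ i, C.userInfo p i ≤ S := by
  obtain ⟨R, hR, hlim⟩ := C.exists_seq_rates p
  refine le_of_tendsto' (tendsto_finsetSum Finset.univ fun i _ => hlim i) fun k => ?_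
  rw [← ENNReal.ofReal_sum_of_nonneg fun i _ => (hR k i).1]
  exact hS _ (hR k)

lemma toReal_userInfo_mem_capacityRegion (hp : ∀ i, C.userInfo p i ≠ ∞) :
    (fun i => (C.userInfo p i).toReal) ∈ C.capacityRegion := by
  obtain ⟨R, hR, hlim⟩ := C.exists_seq_rates p
  refine isClosed_closure.mem_of_tendsto (b := atTop) (f := R) (tendsto_pi_nhds.2 fun i => ?_)
    (Eventually.of_forall fun k => C.mem_capacityRegion (hR k))
  refine ((ENNReal.tendsto_toReal (hp i)).comp (hlim i)).congr fun k => ?_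
  exact ENNReal.toReal_ofReal (hR k i).1

theorem sumCapacity_eq (hC : C.IsDegraded) :
    C.sumCapacity = ⨆ p : ∀ i, ProbabilityMeasure (X i), ∑ i, C.userInfo p i := by
  refine le_antisymm (iSup₂_le fun R hR => C.sum_rate_le_of_mem_capacityRegion hC
    (le_iSup fun p => ∑ i, C.userInfo p i) hR) (iSup_le fun p => C.sum_userInfo_le fun R hR => ?_)
  exact le_iSup₂ (f := fun R (_ : R ∈ C.capacityRegion) => ENNReal.ofReal (∑ i, R i)) R
    (C.mem_capacityRegion hR)

theorem sumCapacity_eq_iSup_randomCoding (hC : C.IsDegraded) :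
    C.sumCapacity = ⨆ (p : ∀ i, ProbabilityMeasure (X i)) (R : Fin (n + 1) → ℝ)
      (_ : C.RandomCodingAchieves p R), ENNReal.ofReal (∑ i, R i) := by
  rw [C.sumCapacity_eq hC]
  refine le_antisymm (iSup_mono fun p => C.sum_userInfo_le fun R hR => ?_)
    (iSup_le fun p => iSup₂_le fun R hR => hR.sum_rate_le hC
      (le_iSup fun p => ∑ i, C.userInfo p i))
  exact le_iSup₂ (f := fun R (_ : C.RandomCodingAchieves p R) => ENNReal.ofReal (∑ i, R i)) R
    (C.randomCodingAchieves hR)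

theorem isGreatest_sum_capacityRegion (hC : C.IsDegraded)
    (hp : ∀ p' : ∀ i, ProbabilityMeasure (X i), ∑ i, C.userInfo p' i ≤ ∑ i, C.userInfo p i)
    (hfin : ∑ i, C.userInfo p i ≠ ∞) :
    IsGreatest ((fun R : Fin (n + 1) → ℝ => ∑ i, R i) '' C.capacityRegion)
      (∑ i, C.userInfo p i).toReal := by
  have hfin' (i) : C.userInfo p i ≠ ∞ := ENNReal.sum_ne_top.1 hfin i (Finset.mem_univ i)
  refine ⟨⟨_, C.toReal_userInfo_mem_capacityRegion hfin', ?_⟩, ?_⟩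
  · exact (ENNReal.toReal_sum fun i _ => hfin' i).symm
  · rintro _ ⟨R, hR, rfl⟩
    exact (ENNReal.ofReal_le_iff_le_toReal hfin).1
      (C.sum_rate_le_of_mem_capacityRegion hC hp hR)

end ManyToOneChannel

/-! ## Finite alphabets -/

section FiniteAlphabet

open InformationTheory Real

lemma prod_absolutelyContinuous_of_finite {A B : Type*} [MeasurableSpace A] [MeasurableSpace B]
    [Finite A] [MeasurableSingletonClass A] (P : Measure (A × B)) [IsProbabilityMeasure P] :
    P ≪ P.fst.prod P.snd := by
  refine Measure.AbsolutelyContinuous.mk fun s hs h => ?_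
  rw [Measure.measure_prod_null hs] at h
  have hsub : s ⊆ ⋃ a, Prod.fst ⁻¹' {a} ∩ Prod.snd ⁻¹' (Prod.mk a ⁻¹' s) := fun z hz =>
    Set.mem_iUnion.2 ⟨z.1, rfl, hz⟩
  refine measure_mono_null hsub (measure_iUnion_null fun a => ?_)
  by_cases ha : P.snd (Prod.mk a ⁻¹' s) = 0
  · rw [Measure.snd_apply (hs.preimage measurable_prodMk_left)] at ha
    exact measure_mono_null Set.inter_subset_right ha
  · have h1 : P.fst {a} = 0 := by
      refine measure_mono_null (fun x hx => ?_) (ae_iff.1 h)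
      rw [Set.mem_singleton_iff.1 hx]
      exact ha
    rw [Measure.fst_apply (measurableSet_singleton a)] at h1
    exact measure_mono_null Set.inter_subset_left h1

/-- The likelihood ratio against a fixed product reference splits into the information density and
the ratios of the two marginals. Mutual information thus becomes a combination of divergences from
fixed laws. -/
lemma toReal_mutualInformation_add {A B : Type*} [MeasurableSpace A] [MeasurableSpace B]
    {P : Measure (A × B)} [IsProbabilityMeasure P] {U : Measure A} [IsProbabilityMeasure U]
    {Λ : Measure B} [IsProbabilityMeasure Λ] (hP : P ≪ P.fst.prod P.snd)
    (h : klDiv P (U.prod Λ) ≠ ∞) (hU : klDiv P.fst U ≠ ∞) (hΛ : klDiv P.snd Λ ≠ ∞) :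
    mutualInformation P ≠ ∞ ∧
      (klDiv P (U.prod Λ)).toReal =
        (mutualInformation P).toReal + (klDiv P.fst U).toReal + (klDiv P.snd Λ).toReal := by
  obtain ⟨hac, hi⟩ := klDiv_ne_top_iff.1 h
  obtain ⟨hacU, hiU⟩ := klDiv_ne_top_iff.1 hU
  obtain ⟨hacΛ, hiΛ⟩ := klDiv_ne_top_iff.1 hΛ
  have hwd : P.fst.prod P.snd = (U.prod Λ).withDensity
      fun z => P.fst.rnDeriv U z.1 * P.snd.rnDeriv Λ z.2 := by
    have h1 := Measure.withDensity_rnDeriv_eq _ _ hacU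
    have h2 := Measure.withDensity_rnDeriv_eq _ _ hacΛ
    have : SFinite (U.withDensity (P.fst.rnDeriv U)) := by rw [h1]; infer_instance
    have : SFinite (Λ.withDensity (P.snd.rnDeriv Λ)) := by rw [h2]; infer_instance
    rw [← prod_withDensity (Measure.measurable_rnDeriv _ _) (Measure.measurable_rnDeriv _ _),
      h1, h2]
  have hQac : P.fst.prod P.snd ≪ U.prod Λ := hacU.prod hacΛ
  have hrn : (P.fst.prod P.snd).rnDeriv (U.prod Λ) =ᵐ[U.prod Λ]
      fun z => P.fst.rnDeriv U z.1 * P.snd.rnDeriv Λ z.2 := by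
    conv_lhs => rw [hwd]
    exact Measure.rnDeriv_withDensity _ (((Measure.measurable_rnDeriv _ _).comp measurable_fst).mul
      ((Measure.measurable_rnDeriv _ _).comp measurable_snd))
  have hf {p : A → Prop} (hp : ∀ᵐ a ∂P.fst, p a) : ∀ᵐ z ∂P, p z.1 :=
    ae_of_ae_map measurable_fst.aemeasurable hp
  have hs {p : B → Prop} (hp : ∀ᵐ b ∂P.snd, p b) : ∀ᵐ z ∂P, p z.2 :=
    ae_of_ae_map measurable_snd.aemeasurable hp
  have hllr : llr P (U.prod Λ) =ᵐ[P] fun z =>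
      llr P (P.fst.prod P.snd) z + (llr P.fst U z.1 + llr P.snd Λ z.2) := by
    filter_upwards [llr_ae_eq_add hP hQac, hac hrn, hf (Measure.rnDeriv_pos hacU),
      hf (hacU (Measure.rnDeriv_lt_top P.fst U)), hs (Measure.rnDeriv_pos hacΛ),
      hs (hacΛ (Measure.rnDeriv_lt_top P.snd Λ))] with z h1 h2 h3 h4 h5 h6
    rw [h1]
    simp only [llr, h2, ENNReal.toReal_mul]
    rw [Real.log_mul (ENNReal.toReal_pos h3.ne' h4.ne).ne' (ENNReal.toReal_pos h5.ne' h6.ne).ne']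
  have hiU' : Integrable (fun z : A × B => llr P.fst U z.1) P :=
    (integrable_map_measure hiU.aestronglyMeasurable measurable_fst.aemeasurable).1 hiU
  have hiΛ' : Integrable (fun z : A × B => llr P.snd Λ z.2) P :=
    (integrable_map_measure hiΛ.aestronglyMeasurable measurable_snd.aemeasurable).1 hiΛ
  have hiP : Integrable (llr P (P.fst.prod P.snd)) P := by
    refine ((hi.congr hllr).sub (hiU'.add hiΛ')).congr (Eventually.of_forall fun z => ?_)
    simp
  have e1 : ∫ a, llr P.fst U a ∂P.fst = ∫ z, llr P.fst U z.1 ∂P :=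
    integral_map measurable_fst.aemeasurable hiU.aestronglyMeasurable
  have e2 : ∫ b, llr P.snd Λ b ∂P.snd = ∫ z, llr P.snd Λ z.2 ∂P :=
    integral_map measurable_snd.aemeasurable hiΛ.aestronglyMeasurable
  refine ⟨klDiv_ne_top hP hiP, ?_⟩
  rw [mutualInformation, toReal_klDiv_of_measure_eq hP (by simp),
    toReal_klDiv_of_measure_eq hacU (by simp), toReal_klDiv_of_measure_eq hacΛ (by simp),
    toReal_klDiv_of_measure_eq hac (by simp), e1, e2, integral_congr_ae hllr,
    add_assoc, ← integral_add hiU' hiΛ']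
  exact integral_add hiP (hiU'.add hiΛ')

lemma exists_density_of_le_smul {Z : Type*} [MeasurableSpace Z] {ν R : Measure Z}
    [IsProbabilityMeasure R] {K : ℝ≥0∞} (hK : K ≠ ∞) (h : ν ≤ K • R) :
    ∃ w : Z → ℝ, Measurable w ∧ (∀ z, 0 ≤ w z ∧ w z ≤ K.toReal) ∧
      ν = R.withDensity fun z => ENNReal.ofReal (w z) := by
  have hfin : IsFiniteMeasure ν := ⟨(h Set.univ).trans_lt (by simp [hK.lt_top])⟩
  have hac : ν ≪ R := (Measure.absolutelyContinuous_of_le h).trans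
    Measure.smul_absolutelyContinuous
  have hle : ν.rnDeriv R ≤ᵐ[R] fun _ => K := by
    refine ae_le_of_forall_setLIntegral_le_of_sigmaFinite (Measure.measurable_rnDeriv _ _)
      fun s _ _ => ?_
    rw [Measure.setLIntegral_rnDeriv hac, setLIntegral_const]
    exact h s
  -- Truncation at `K` makes the bound on the density hold everywhere, not only almost everywhere.
  refine ⟨fun z => (min (ν.rnDeriv R z) K).toReal,
    ((Measure.measurable_rnDeriv _ _).min measurable_const).ennreal_toReal,
    fun z => ⟨ENNReal.toReal_nonneg, ENNReal.toReal_mono hK (min_le_right _ _)⟩, ?_⟩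
  refine (Measure.withDensity_rnDeriv_eq ν R hac).symm.trans (withDensity_congr_ae ?_)
  filter_upwards [hle] with z hz
  rw [min_eq_left hz, ENNReal.ofReal_toReal (ne_top_of_le_ne_top hK hz)]

/-- The densities are finite mixtures of bounded functions with continuous weights, so they stay in
a fixed compact interval, on which `klFun` is bounded; dominated convergence applies. -/
lemma continuous_klDiv_mixture {Θ Ξ Z : Type*} [TopologicalSpace Θ] [FirstCountableTopology Θ]
    [Fintype Ξ] [MeasurableSpace Z] {R : Measure Z} [IsProbabilityMeasure R] {ν : Ξ → Measure Z}
    {K : Ξ → ℝ≥0∞} (hK : ∀ x, K x ≠ ∞) (hν : ∀ x, ν x ≤ K x • R) {g : Θ → Ξ → ℝ}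
    (hg : ∀ x, Continuous fun θ => g θ x) (hg0 : ∀ θ x, 0 ≤ g θ x) (hg1 : ∀ θ x, g θ x ≤ 1)
    (Q : Θ → Measure Z) [∀ θ, IsProbabilityMeasure (Q θ)]
    (hQ : ∀ θ, Q θ = ∑ x, ENNReal.ofReal (g θ x) • ν x) :
    (∀ θ, klDiv (Q θ) R ≠ ∞) ∧ Continuous fun θ => (klDiv (Q θ) R).toReal := by
  choose w hwm hw hwd using fun x => exists_density_of_le_smul (hK x) (hν x)
  set u : Θ → Z → ℝ := fun θ z => ∑ x, g θ x * w x z with hu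
  have hum (θ) : Measurable (u θ) := Finset.measurable_sum _ fun x _ => (hwm x).const_mul _
  have hmem (θ z) : u θ z ∈ Set.Icc 0 (∑ x, (K x).toReal) := by
    refine ⟨Finset.sum_nonneg fun x _ => mul_nonneg (hg0 θ x) (hw x z).1,
      Finset.sum_le_sum fun x _ => ?_⟩
    calc g θ x * w x z ≤ 1 * w x z := mul_le_mul_of_nonneg_right (hg1 θ x) (hw x z).1
      _ ≤ (K x).toReal := by rw [one_mul]; exact (hw x z).2
  have hQu (θ) : Q θ = R.withDensity fun z => ENNReal.ofReal (u θ z) := by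
    ext s hs
    have h1 (z) : ENNReal.ofReal (u θ z) =
        ∑ x, ENNReal.ofReal (g θ x) * ENNReal.ofReal (w x z) := by
      rw [hu, ENNReal.ofReal_sum_of_nonneg fun x _ => mul_nonneg (hg0 θ x) (hw x z).1]
      exact Finset.sum_congr rfl fun x _ => ENNReal.ofReal_mul (hg0 θ x)
    rw [hQ, withDensity_apply _ hs, Measure.finsetSum_apply]
    simp_rw [h1]
    rw [lintegral_finsetSum _ fun x _ => (hwm x).ennreal_ofReal.const_mul _]
    refine Finset.sum_congr rfl fun x _ => ?_
    rw [lintegral_const_mul _ (hwm x).ennreal_ofReal, Measure.smul_apply, smul_eq_mul,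
      hwd x, withDensity_apply _ hs]
  have hac (θ) : Q θ ≪ R := by rw [hQu]; exact withDensity_absolutelyContinuous _ _
  have hrn (θ) : (fun z => klFun ((Q θ).rnDeriv R z).toReal) =ᵐ[R] fun z => klFun (u θ z) := by
    have := Measure.rnDeriv_withDensity R (hum θ).ennreal_ofReal
    rw [← hQu] at this
    filter_upwards [this] with z hz
    rw [hz, ENNReal.toReal_ofReal (hmem θ z).1]
  obtain ⟨D, hD⟩ := (isCompact_Icc (a := (0 : ℝ)) (b := ∑ x, (K x).toReal)
    ).exists_bound_of_continuousOn
    continuous_klFun.continuousOn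
  have hint (θ) : Integrable (fun z => klFun (u θ z)) R :=
    (integrable_const D).mono' (continuous_klFun.measurable.comp (hum θ)).aestronglyMeasurable
      (Eventually.of_forall fun z => hD _ (hmem θ z))
  refine ⟨fun θ => klDiv_ne_top (hac θ) ((integrable_klFun_rnDeriv_iff (hac θ)).1
    ((hint θ).congr (hrn θ).symm)), ?_⟩
  have heq (θ) : (klDiv (Q θ) R).toReal = ∫ z, klFun (u θ z) ∂(R) := by
    rw [toReal_klDiv_eq_integral_klFun (hac θ), integral_congr_ae (hrn θ)]
  simp_rw [heq]
  refine continuous_of_dominated (bound := fun _ => D) (fun θ => (hint θ).aestronglyMeasurable)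
    (fun θ => Eventually.of_forall fun z => hD _ (hmem θ z)) (integrable_const D)
    (Eventually.of_forall fun z => continuous_klFun.comp ?_)
  exact continuous_finsetSum _ fun x _ => (hg x).mul continuous_const

lemma continuous_mutualInformation_mixture {Θ Ξ A B : Type*} [TopologicalSpace Θ]
    [FirstCountableTopology Θ] [Fintype Ξ] [MeasurableSpace A] [MeasurableSpace B] [Finite A]
    [MeasurableSingletonClass A] {U : Measure A} [IsProbabilityMeasure U] {Λ : Measure B}
    [IsProbabilityMeasure Λ] {ν : Ξ → Measure (A × B)} {K : Ξ → ℝ≥0∞} (hK : ∀ x, K x ≠ ∞)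
    (hν : ∀ x, ν x ≤ K x • U.prod Λ) {g : Θ → Ξ → ℝ} (hg : ∀ x, Continuous fun θ => g θ x)
    (hg0 : ∀ θ x, 0 ≤ g θ x) (hg1 : ∀ θ x, g θ x ≤ 1) (P : Θ → Measure (A × B))
    [∀ θ, IsProbabilityMeasure (P θ)] (hP : ∀ θ, P θ = ∑ x, ENNReal.ofReal (g θ x) • ν x) :
    (∀ θ, mutualInformation (P θ) ≠ ∞) ∧ Continuous fun θ => (mutualInformation (P θ)).toReal := by
  have hfst (θ) : (P θ).fst = ∑ x, ENNReal.ofReal (g θ x) • (ν x).fst := by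
    ext s hs
    simp_rw [Measure.fst_apply hs, hP, Measure.finsetSum_apply, Measure.smul_apply,
      Measure.fst_apply hs]
  have hsnd (θ) : (P θ).snd = ∑ x, ENNReal.ofReal (g θ x) • (ν x).snd := by
    ext s hs
    simp_rw [Measure.snd_apply hs, hP, Measure.finsetSum_apply, Measure.smul_apply,
      Measure.snd_apply hs]
  have hνfst (x) : (ν x).fst ≤ K x • U := by
    have := Measure.map_mono (hν x) measurable_fst
    rwa [Measure.map_smul, ← Measure.fst, ← Measure.fst, Measure.fst_prod] at this
  have hνsnd (x) : (ν x).snd ≤ K x • Λ := by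
    have := Measure.map_mono (hν x) measurable_snd
    rwa [Measure.map_smul, ← Measure.snd, ← Measure.snd, Measure.snd_prod] at this
  obtain ⟨h1, c1⟩ := continuous_klDiv_mixture hK hν hg hg0 hg1 P hP
  obtain ⟨h2, c2⟩ := continuous_klDiv_mixture hK hνfst hg hg0 hg1 (fun θ => (P θ).fst) hfst
  obtain ⟨h3, c3⟩ := continuous_klDiv_mixture hK hνsnd hg hg0 hg1 (fun θ => (P θ).snd) hsnd
  have h (θ) := toReal_mutualInformation_add (prod_absolutelyContinuous_of_finite (P θ))
    (h1 θ) (h2 θ) (h3 θ)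
  refine ⟨fun θ => (h θ).1, ((c1.sub c2).sub c3).congr fun θ => ?_⟩
  simp only [Pi.sub_apply, (h θ).2]
  ring

end FiniteAlphabet

/-! ### Input laws as points of a compact simplex -/

section Simplex

variable {A : Type*} [Fintype A] [MeasurableSpace A]

/-- The probability measure on a finite type given by a point of the standard simplex. -/
def simplexMeasure (θ : stdSimplex ℝ A) : ProbabilityMeasure A :=
  ⟨∑ a, ENNReal.ofReal (θ.1 a) • Measure.dirac a, ⟨by
    rw [Measure.finsetSum_apply]
    simp only [Measure.smul_apply, measure_univ, smul_eq_mul, mul_one]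
    rw [← ENNReal.ofReal_sum_of_nonneg fun a _ => θ.2.1 a, θ.2.2, ENNReal.ofReal_one]⟩⟩

variable [MeasurableSingletonClass A]

lemma simplexMeasure_singleton (θ : stdSimplex ℝ A) (a : A) :
    (simplexMeasure θ : Measure A) {a} = ENNReal.ofReal (θ.1 a) := by
  classical
  change (∑ a, ENNReal.ofReal (θ.1 a) • Measure.dirac a : Measure A) {a} = _
  rw [Measure.finsetSum_apply]
  simp [Set.indicator_apply]

lemma simplexMeasure_surjective : Function.Surjective (simplexMeasure (A := A)) := by
  intro p
  have hsum : ∑ a, (p : Measure A) {a} = 1 := by simp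
  refine ⟨⟨fun a => ((p : Measure A) {a}).toReal, fun a => ENNReal.toReal_nonneg, ?_⟩, ?_⟩
  · rw [← ENNReal.toReal_sum fun a _ => measure_ne_top _ _, hsum, ENNReal.toReal_one]
  · refine Subtype.ext (Measure.ext_iff_singleton.2 fun a => ?_)
    refine (simplexMeasure_singleton _ a).trans ?_
    exact ENNReal.ofReal_toReal (measure_ne_top _ _)

end Simplex

namespace ManyToOneChannel

variable {n : ℕ} {X Y : Fin (n + 1) → Type*} {V : Type*}
  [∀ i, MeasurableSpace (X i)] [∀ i, MeasurableSpace (Y i)] [MeasurableSpace V]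
  (C : ManyToOneChannel n X Y V) [∀ i, Fintype (X i)] [∀ i, MeasurableSingletonClass (X i)]

lemma userLaw_eq_sum (p : ∀ i, ProbabilityMeasure (X i)) (i : Fin (n + 1)) :
    C.userLaw p i = ∑ x : ∀ j, X j,
      (∏ j, (p j : Measure (X j)) {x j}) • (C.outputKernel i x).map (Prod.mk (x i)) := by
  ext s hs
  rw [userLaw_eq_map, Measure.map_apply (by fun_prop) hs,
    Measure.compProd_apply (hs.preimage (by fun_prop)), lintegral_fintype, Measure.finsetSum_apply]
  refine Finset.sum_congr rfl fun x _ => ?_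
  rw [Measure.smul_apply, Measure.map_apply measurable_prodMk_left hs, Measure.pi_singleton,
    smul_eq_mul, mul_comm]
  rfl

/-- If all input letters have positive mass, the output law contains the transition law from `x`
with weight `c`, the probability of `x`, and the law of input `i` has an atom of mass `d` at `x i`.
So `(c * d)⁻¹` is a valid factor. -/
lemma exists_map_outputKernel_le {p : ∀ i, ProbabilityMeasure (X i)}
    (hp : ∀ i a, (p i : Measure (X i)) {a} ≠ 0) (i : Fin (n + 1)) (x : ∀ j, X j) :
    ∃ K : ℝ≥0∞, K ≠ ∞ ∧ (C.outputKernel i x).map (Prod.mk (x i)) ≤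
      K • (p i : Measure (X i)).prod (C.userLaw p i).snd := by
  set c := ∏ j, (p j : Measure (X j)) {x j} with hc
  have hc0 : c ≠ 0 := Finset.prod_ne_zero_iff.2 fun j _ => hp j (x j)
  have hct : c ≠ ∞ := ENNReal.prod_ne_top fun j _ => measure_ne_top _ _
  set d := (p i : Measure (X i)) {x i} with hd
  have hdt : d ≠ ∞ := measure_ne_top _ _
  refine ⟨(c * d)⁻¹, ENNReal.inv_ne_top.2 (mul_ne_zero hc0 (hp i (x i))),
    Measure.le_iff.2 fun s hs => ?_⟩
  have hsx : MeasurableSet (Prod.mk (x i) ⁻¹' s) := hs.preimage measurable_prodMk_left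
  have h1 : c * C.outputKernel i x (Prod.mk (x i) ⁻¹' s) ≤
      (C.userLaw p i).snd (Prod.mk (x i) ⁻¹' s) := by
    rw [Measure.snd_apply hsx, userLaw_eq_sum, Measure.finsetSum_apply]
    refine le_trans (le_of_eq ?_) (Finset.single_le_sum
      (f := fun x' : ∀ j, X j => ((∏ j, (p j : Measure (X j)) {x' j}) •
        (C.outputKernel i x').map (Prod.mk (x' i))) (Prod.snd ⁻¹' (Prod.mk (x i) ⁻¹' s)))
      (fun _ _ => zero_le) (Finset.mem_univ x))
    rw [Measure.smul_apply, Measure.map_apply measurable_prodMk_left (hsx.preimage measurable_snd)]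
    rfl
  have h2 : (C.userLaw p i).snd (Prod.mk (x i) ⁻¹' s) * d ≤
      ((p i : Measure (X i)).prod (C.userLaw p i).snd) s := by
    rw [Measure.prod_apply hs, lintegral_fintype]
    exact Finset.single_le_sum (f := fun a => (C.userLaw p i).snd (Prod.mk a ⁻¹' s) *
      (p i : Measure (X i)) {a}) (fun _ _ => zero_le) (Finset.mem_univ (x i))
  rw [Measure.map_apply measurable_prodMk_left hs, Measure.smul_apply, smul_eq_mul]
  calc C.outputKernel i x (Prod.mk (x i) ⁻¹' s)
      = (c * d)⁻¹ * (c * d * C.outputKernel i x (Prod.mk (x i) ⁻¹' s)) := by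
        rw [← mul_assoc, ENNReal.inv_mul_cancel (mul_ne_zero hc0 (hp i (x i)))
          (ENNReal.mul_ne_top hct hdt), one_mul]
    _ ≤ _ := by
        gcongr
        rw [mul_right_comm]
        exact (mul_le_mul_left h1 d).trans h2

variable [∀ i, Nonempty (X i)]

lemma continuous_userInfo (i : Fin (n + 1)) :
    (∀ θ : ∀ j, stdSimplex ℝ (X j), C.userInfo (fun j => simplexMeasure (θ j)) i ≠ ∞) ∧
      Continuous fun θ : ∀ j, stdSimplex ℝ (X j) =>
        (C.userInfo (fun j => simplexMeasure (θ j)) i).toReal := by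
  -- Uniform inputs have full support, so the laws they induce dominate those of all other inputs,
  -- with bounded densities.
  set θ₀ : ∀ j, stdSimplex ℝ (X j) := fun j => ⟨fun _ => (Fintype.card (X j) : ℝ)⁻¹,
    fun _ => by positivity, by simp⟩ with hθ₀
  have hp (j) (a : X j) : (simplexMeasure (θ₀ j) : Measure (X j)) {a} ≠ 0 := by
    rw [simplexMeasure_singleton]
    simp [hθ₀, Fintype.card_pos]
  choose K hK hle using fun x =>
    C.exists_map_outputKernel_le (p := fun j => simplexMeasure (θ₀ j)) hp i x
  have hle1 (j) (θ : stdSimplex ℝ (X j)) (a : X j) : θ.1 a ≤ 1 := by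
    rw [← θ.2.2]
    exact Finset.single_le_sum (fun b _ => θ.2.1 b) (Finset.mem_univ a)
  refine continuous_mutualInformation_mixture hK hle
    (g := fun (θ : ∀ j, stdSimplex ℝ (X j)) x => ∏ j, (θ j).1 (x j)) (fun x => ?_)
    (fun θ x => Finset.prod_nonneg fun j _ => (θ j).2.1 _)
    (fun θ x => Finset.prod_le_one (fun j _ => (θ j).2.1 _) fun j _ => hle1 j _ _)
    (fun θ => C.userLaw (fun j => simplexMeasure (θ j)) i) fun θ => ?_
  · exact continuous_finsetProd _ fun j _ =>
      (continuous_apply (x j)).comp (continuous_subtype_val.comp (continuous_apply j))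
  · rw [userLaw_eq_sum]
    refine Finset.sum_congr rfl fun x _ => ?_
    rw [ENNReal.ofReal_prod_of_nonneg fun j _ => (θ j).2.1 _]
    simp_rw [simplexMeasure_singleton]

theorem exists_isMax_sum_userInfo : ∃ p : ∀ i, ProbabilityMeasure (X i),
    (∀ p' : ∀ i, ProbabilityMeasure (X i), ∑ i, C.userInfo p' i ≤ ∑ i, C.userInfo p i) ∧
      ∑ i, C.userInfo p i ≠ ∞ := by
  have hfin (θ : ∀ j, stdSimplex ℝ (X j)) :
      ∑ i, C.userInfo (fun j => simplexMeasure (θ j)) i ≠ ∞ :=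
    ENNReal.sum_ne_top.2 fun i _ => (C.continuous_userInfo i).1 θ
  have hcont : Continuous fun θ : ∀ j, stdSimplex ℝ (X j) =>
      (∑ i, C.userInfo (fun j => simplexMeasure (θ j)) i).toReal := by
    refine (continuous_finsetSum Finset.univ fun i _ => (C.continuous_userInfo i).2).congr
      fun θ => ?_
    exact (ENNReal.toReal_sum fun i _ => (C.continuous_userInfo i).1 θ).symm
  obtain ⟨θ, -, hθ⟩ := isCompact_univ.exists_isMaxOn Set.univ_nonempty hcont.continuousOn
  refine ⟨fun j => simplexMeasure (θ j), fun p' => ?_, hfin θ⟩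
  choose θ' hθ' using fun j => simplexMeasure_surjective (p' j)
  obtain rfl : (fun j => simplexMeasure (θ' j)) = p' := funext hθ'
  exact (ENNReal.toReal_le_toReal (hfin θ') (hfin θ)).1 (hθ (Set.mem_univ θ'))

end ManyToOneChannel

end

theorem theorem1 {n : ℕ} {X Y : Fin (n + 1) → Type*} {V : Type*}
    [∀ i, MeasurableSpace (X i)] [∀ i, MeasurableSpace (Y i)] [MeasurableSpace V]
    [∀ i, Nonempty (X i)]
    (C : ManyToOneChannel n X Y V) (hC : C.IsDegraded) :
    -- the sum-capacity formula
    C.sumCapacity = ⨆ p : ∀ i, ProbabilityMeasure (X i), ∑ i, C.userInfo p i ∧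
    -- the sum-capacity is achieved by random coding with interference treated as noise
    C.sumCapacity = ⨆ (p : ∀ i, ProbabilityMeasure (X i)) (R : Fin (n + 1) → ℝ)
      (_ : C.RandomCodingAchieves p R), ENNReal.ofReal (∑ i, R i) ∧
    -- with input laws `p` it achieves all rates below the single-letter mutual informations
    (∀ (p : ∀ i, ProbabilityMeasure (X i)) (R : Fin (n + 1) → ℝ),
      (∀ i, 0 ≤ R i ∧ (R i = 0 ∨ ENNReal.ofReal (R i) < C.userInfo p i)) →
        C.RandomCodingAchieves p R) ∧
    -- for finite input alphabets, the suprema are finite and are maxima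
    ((∀ i, Finite (X i)) → (∀ i, MeasurableSingletonClass (X i)) →
      ∃ p : ∀ i, ProbabilityMeasure (X i),
        (∀ p' : ∀ i, ProbabilityMeasure (X i),
          ∑ i, C.userInfo p' i ≤ ∑ i, C.userInfo p i) ∧
        ∑ i, C.userInfo p i ≠ ∞ ∧
        IsGreatest ((fun R : Fin (n + 1) → ℝ => ∑ i, R i) '' C.capacityRegion)
          (∑ i, C.userInfo p i).toReal) := by
  refine ⟨C.sumCapacity_eq hC, C.sumCapacity_eq_iSup_randomCoding hC,
    fun p R hR => C.randomCodingAchieves hR, fun hfin hsing => ?_⟩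
  have hX (i) : Fintype (X i) := Fintype.ofFinite (X i)
  obtain ⟨p, hp, hp'⟩ := C.exists_isMax_sum_userInfo
  exact ⟨p, hp, hp', C.isGreatest_sum_capacityRegion hC hp hp'⟩
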